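/- Let $\mathfrak X_0$ be an integral normal scheme which is flat and of finite type over $\operatorname{Spec}\mathbb Z$, with function field $K_0$. Let $K/K_0$ be a Galois extension with group $G$ such that every polynomial $T^N-a$ ($N\ge 1$, $a\in K$) splits into linear factors over $K$. Let $\mathfrak X$ be the normalization of $\mathfrak X_0$ in $K$, with projection $\pi:\mathfrak X\to\mathfrak X_0$. Fix a condition $\mathcal E$ on homomorphisms $\chi:\kappa(\mathfrak x)^\times\to\mathbb C^\times$, $\mathfrak x\in\mathfrak X$, such that: if $\ker\chi$ is finite, then $\chi$ satisfies $\mathcal E$; if $\chi$ satisfies $\mathcal E$, then $(\ker\chi)_{\rm tors}$ is finite, and $\kappa(\mathfrak x)^\times$ is torsion whenever $\operatorname{im}\chi$ consists of roots of unity; and $\mathcal E$ is stable under $\chi\mapsto\chi^\nu$ ($\nu\ge1$) and under $G$. Let $\overset{\bullet}{\mathfrak X}(\mathbb C)$ be the set of pairs $P=(\mathfrak x,\chi)$ with $\mathfrak x\in\mathfrak X$ and $\chi:\kappa(\mathfrak x)^\times\to\mathbb C^\times$ satisfying $\mathcal E$. The group $G$ acts by $(\mathfrak x,\chi)^\sigma=(\sigma^{-1}\mathfrak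 x,\chi\circ\sigma)$, and the positive integers, under multiplication, act by $F_\nu(\mathfrak x,\chi)=(\mathfrak x,\chi^\nu)$. If $U_0\subset\mathfrak X_0$ is an affine open subset with $\pi^{-1}(U_0)=\operatorname{Spec}R$, the pairs over $U_0$ are viewed as multiplicative maps $R\to\mathbb C$ and carry the topology of pointwise convergence; a subset of $\overset{\bullet}{\mathfrak X}(\mathbb C)$ is open if its part over every such $U_0$ is open. Put $\overset{\bullet}{\mathfrak X}_0(\mathbb C)=\overset{\bullet}{\mathfrak X}(\mathbb C)/G$ with the quotient topology, and let $\check{\mathfrak X}_0(\mathbb C)$ be the colimit of copies of $\overset{\bullet}{\mathfrak X}_0(\mathbb C)$ over the positive integers ordered by divisibility, with transition maps the $F_\nu$ and with the inductive limit topology. On it $\mathbb Q^{>0}$ acts by $F_{\nu/\nu'}=F_\nu F_{\nu'}^{-1}$, and $\pi$ induces a $\mathbb Q^{>0}$-invariant projection $\mathrm{pr}_0:\check{\mathfrak X}_0(\mathbb C)\to\mathfrak X_0$. Let $$X_0=\check{\mathfrak X}_0(\mathbb C)\times_{\mathbb Q^{>0}}\mathbb R^{>0}$$ be the quotient of $\check{\mathfrak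 X}_0(\mathbb C)\times\mathbb R^{>0}$ by the action $q(P_0,u)=(F_q^{-1}P_0,qu)$, with the quotient topology, on which $v\in\mathbb R^{>0}$ acts by $[P_0,u]\cdot v=[P_0,uv]$, and write $\phi^t$ for the action of $e^t$, $t\in\mathbb R$. For a closed point $\mathfrak x_0$ of $\mathfrak X_0$ let $N\mathfrak x_0=|\kappa(\mathfrak x_0)|$ and $\Gamma_{\mathfrak x_0}=\mathrm{pr}_0^{-1}(\mathfrak x_0)\times_{\mathbb Q^{>0}}\mathbb R^{>0}\subset X_0$. Then the following hold, where $\mathfrak x_0$ runs over the closed points of $\mathfrak X_0$. 1. $\{x\in X_0\mid(\mathbb R^{>0})_x\ne1\}=\coprod_{\mathfrak x_0}\Gamma_{\mathfrak x_0}$, a disjoint union. 2. Every point $x\in\Gamma_{\mathfrak x_0}$ has isotropy group $(\mathbb R^{>0})_x=(N\mathfrak x_0)^{\mathbb Z}$. 3. The closed points correspond bijectively to compact packets of periodic orbits of the flow $\phi$: for every $\mathfrak x_0$ the field $\kappa(\mathfrak x_0)$ is finite, and $\Gamma_{\mathfrak x_0}$ is nonempty, compact (in the sense that every open cover has a finite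 subcover), and a union of periodic orbits of length $\log N\mathfrak x_0$. Every periodic orbit in $X_0$ lies in $\Gamma_{\mathfrak x_0}$ for exactly one closed point $\mathfrak x_0$. 4. The flow $\phi$ has no fixed points. -/

import Mathlib

open AlgebraicGeometry CategoryTheory

universe u

noncomputable section

namespace ArithDyn

/-- An arithmetic scheme: an integral normal scheme, flat and of finite type over `Spec ℤ`. -/
class IsArithmeticScheme (X : Scheme.{u}) : Prop extends AlgebraicGeometry.IsIntegral X where
  normal : ∀ x : X, IsIntegrallyClosed (X.presheaf.stalk x)
  flat : Flat (specULiftZIsTerminal.{u}.from X)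
  locallyOfFiniteType : LocallyOfFiniteType (specULiftZIsTerminal.{u}.from X)
  quasiCompact : QuasiCompact (specULiftZIsTerminal.{u}.from X)

/-- A field is radicially closed if every polynomial `T ^ N - a` is a product of linear factors. -/
def IsRadiciallyClosed (K : Type u) [Field K] : Prop :=
  ∀ (N : ℕ), 0 < N → ∀ a : K, (Polynomial.X ^ N - Polynomial.C a : Polynomial K).Splits

section Normalization

variable (X₀ : Scheme.{u}) [AlgebraicGeometry.IsIntegral X₀]
  (K : Type u) [Field K] [Algebra X₀.functionField K]

/-- The morphism `Spec K ⟶ X₀` over the generic point, for an extension `K` of the function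
field of `X₀`. -/
def genericMap : Spec (.of K) ⟶ X₀ :=
  Spec.map (CommRingCat.ofHom (algebraMap X₀.functionField K)) ≫
    X₀.fromSpecStalk (genericPoint X₀)

instance : QuasiCompact (genericMap X₀ K) where
  isCompact_preimage _ _ _ := TopologicalSpace.NoetherianSpace.isCompact _

/-- The normalization of `X₀` in `K`. -/
abbrev normalizationIn : Scheme.{u} := (genericMap X₀ K).normalization

/-- The projection of the normalization to `X₀`. -/
abbrev normProj : normalizationIn X₀ K ⟶ X₀ := (genericMap X₀ K).fromNormalization

variable {K}

/-- The automorphism of `Spec K` dual to `σ`. -/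
def specGal (σ : Gal(K/X₀.functionField)) : Spec (.of K) ⟶ Spec (.of K) :=
  Spec.map (CommRingCat.ofHom (σ : K →+* K))

lemma specGal_genericMap (σ : Gal(K/X₀.functionField)) :
    specGal X₀ σ ≫ genericMap X₀ K = genericMap X₀ K := by
  unfold specGal genericMap
  rw [← Category.assoc, ← Spec.map_comp]
  congr 2
  ext x
  simp

/-- The morphism induced by `σ` on the normalization by functoriality; on an affine piece `Spec R`
it is the spectrum of `σ : R → R`, so on points it is `x ↦ σ⁻¹ x`. -/
def galMap (σ : Gal(K/X₀.functionField)) : normalizationIn X₀ K ⟶ normalizationIn X₀ K :=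
  (genericMap X₀ K).normalizationDesc (specGal X₀ σ ≫ (genericMap X₀ K).toNormalization)
    (genericMap X₀ K).fromNormalization (by
      rw [Category.assoc, Scheme.Hom.toNormalization_fromNormalization, specGal_genericMap])

lemma galMap_normProj (σ : Gal(K/X₀.functionField)) :
    galMap X₀ σ ≫ normProj X₀ K = normProj X₀ K :=
  Scheme.Hom.normalizationDesc_comp ..

lemma toNormalization_galMap (σ : Gal(K/X₀.functionField)) :
    (genericMap X₀ K).toNormalization ≫ galMap X₀ σ =
      specGal X₀ σ ≫ (genericMap X₀ K).toNormalization :=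
  Scheme.Hom.toNormalization_normalizationDesc ..

lemma galMap_one : galMap X₀ (1 : Gal(K/X₀.functionField)) = 𝟙 _ := by
  refine Scheme.Hom.normalization.hom_ext _ _ _ (normProj X₀ K) ?_
    (galMap_normProj _ _) (Category.id_comp _)
  rw [toNormalization_galMap]
  have : specGal X₀ (1 : Gal(K/X₀.functionField)) = 𝟙 _ := by
    unfold specGal
    rw [← Spec.map_id]
    rfl
  rw [this, Category.id_comp]
  exact (Category.comp_id _).symm

lemma galMap_mul (σ τ : Gal(K/X₀.functionField)) :
    galMap X₀ (σ * τ) = galMap X₀ σ ≫ galMap X₀ τ := by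
  refine Scheme.Hom.normalization.hom_ext _ _ _ (normProj X₀ K) ?_
    (galMap_normProj _ _) (by rw [Category.assoc, galMap_normProj, galMap_normProj])
  have : specGal X₀ (σ * τ) = specGal X₀ σ ≫ specGal X₀ τ := by
    unfold specGal
    rw [← Spec.map_comp]
    rfl
  have h := toNormalization_galMap X₀ σ
  have h' := toNormalization_galMap X₀ τ
  rw [toNormalization_galMap, this, ← Category.assoc, h, Category.assoc, Category.assoc, h']

lemma normProj_galMap (σ : Gal(K/X₀.functionField)) (x : normalizationIn X₀ K) :
    normProj X₀ K (galMap X₀ σ x) = normProj X₀ K x := by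
  rw [← Scheme.Hom.comp_apply, galMap_normProj]

end Normalization

section Points

/-- Multiplicative characters `κ(x)ˣ → ℂˣ` of the residue field at a point `x`. -/
abbrev ResidueChar {X : Scheme.{u}} (x : X) : Type u := (X.residueField x)ˣ →* ℂˣ

/-- Pull back a character along a morphism: compose with `κ(f x)ˣ → κ(x)ˣ`. -/
def ResidueChar.pullback {X Y : Scheme.{u}} (f : X ⟶ Y) {x : X} (χ : ResidueChar x) :
    ResidueChar (f x) :=
  χ.comp (Units.map (f.residueFieldMap x).hom.toMonoidHom)

/-- The strongest condition: the kernel is finite. -/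
def FiniteKernel {X : Scheme.{u}} {x : X} (χ : ResidueChar x) : Prop :=
  Finite χ.ker

/-- The weakest condition: the torsion of the kernel is finite, and if all values are roots of
unity, then `κ(x)ˣ` is torsion. -/
def MaxCondition {X : Scheme.{u}} {x : X} (χ : ResidueChar x) : Prop :=
  Finite (CommGroup.torsion χ.ker) ∧
    ((∀ y, IsOfFinOrder (χ y)) → IsMulTorsion (X.residueField x)ˣ)

variable (X₀ : Scheme.{u}) [AlgebraicGeometry.IsIntegral X₀]
  (K : Type u) [Field K] [Algebra X₀.functionField K]

/-- A condition on the characters `κ(x)ˣ → ℂˣ`, for `x` in the normalization of `X₀` in `K`. It lies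
between the strongest and the weakest one, and it is stable under `χ ↦ χ ^ ν` and under the Galois
group, so that the operations on points below are defined. -/
structure CharCondition where
  holds : ∀ {x : normalizationIn X₀ K}, ResidueChar x → Prop
  of_finiteKernel : ∀ {x : normalizationIn X₀ K} (χ : ResidueChar x), FiniteKernel χ → holds χ
  maxCondition : ∀ {x : normalizationIn X₀ K} (χ : ResidueChar x), holds χ → MaxCondition χ
  pow : ∀ {x : normalizationIn X₀ K} (χ : ResidueChar x) (ν : ℕ+), holds χ → holds (χ ^ (ν : ℕ))
  pullback : ∀ {x : normalizationIn X₀ K} (χ : ResidueChar x) (σ : Gal(K/X₀.functionField)),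
    holds χ → holds (χ.pullback (galMap X₀ σ))

variable {X₀ K}

/-- The pairs `(x, χ)` of a point `x` of the normalization of `X₀` in `K` and a
character `χ : κ(x)ˣ → ℂˣ` that satisfies the condition `E`. -/
@[ext]
structure Pt (E : CharCondition X₀ K) : Type u where
  pt : normalizationIn X₀ K
  char : ResidueChar pt
  holds : E.holds char

namespace Pt

variable {E : CharCondition X₀ K}

/-- The Galois action `(x, χ) ^ σ = (σ⁻¹ x, χ ∘ σ)`. -/
def gal (P : Pt E) (σ : Gal(K/X₀.functionField)) : Pt E :=
  ⟨galMap X₀ σ P.pt, P.char.pullback (galMap X₀ σ), E.pullback _ _ P.holds⟩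

lemma ext_of_eq {f g : normalizationIn X₀ K ⟶ normalizationIn X₀ K} (h : f = g)
    {x : normalizationIn X₀ K} (χ : ResidueChar x) {hf : E.holds (χ.pullback f)}
    {hg : E.holds (χ.pullback g)} :
    (⟨f x, χ.pullback f, hf⟩ : Pt E) = ⟨g x, χ.pullback g, hg⟩ := by
  subst h; rfl

lemma pullback_id {X : Scheme.{u}} {x : X} (χ : ResidueChar x) : χ.pullback (𝟙 X) = χ := by
  unfold ResidueChar.pullback
  rw [Scheme.residueFieldMap_id]
  rfl

lemma pullback_comp {X Y Z : Scheme.{u}} (f : X ⟶ Y) (g : Y ⟶ Z) {x : X} (χ : ResidueChar x) :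
    χ.pullback (f ≫ g) = (χ.pullback f).pullback g := by
  unfold ResidueChar.pullback
  rw [Scheme.residueFieldMap_comp]
  rfl

lemma gal_one (P : Pt E) : P.gal 1 = P := by
  have h : E.holds (P.char.pullback (𝟙 (normalizationIn X₀ K))) := by
    rw [pullback_id]; exact P.holds
  refine (ext_of_eq (galMap_one X₀) P.char (hg := h)).trans ?_
  cases P
  congr 1
  exact pullback_id _

lemma gal_mul (P : Pt E) (σ τ : Gal(K/X₀.functionField)) :
    P.gal (σ * τ) = (P.gal σ).gal τ := by
  have h : E.holds (P.char.pullback (galMap X₀ σ ≫ galMap X₀ τ)) := by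
    rw [pullback_comp]; exact E.pullback _ _ (E.pullback _ _ P.holds)
  refine (ext_of_eq (galMap_mul X₀ σ τ) P.char (hg := h)).trans ?_
  unfold gal
  congr 1
  exact pullback_comp _ _ _

/-- The Galois group acts from the right, that is, its opposite group acts from the left. -/
instance : MulAction (Gal(K/X₀.functionField))ᵐᵒᵖ (Pt E) where
  smul σ P := P.gal σ.unop
  one_smul := gal_one
  mul_smul σ τ P := gal_mul P τ.unop σ.unop

/-- The Frobenius map `F_ν (x, χ) = (x, χ ∘ ( )^ν) = (x, χ ^ ν)`. -/
def frob (ν : ℕ+) (P : Pt E) : Pt E := ⟨P.pt, P.char ^ (ν : ℕ), E.pow _ _ P.holds⟩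

lemma frob_gal (ν : ℕ+) (P : Pt E) (σ : Gal(K/X₀.functionField)) :
    (P.frob ν).gal σ = (P.gal σ).frob ν := rfl

/-- The positive integers act through the maps `F_ν`. -/
instance : MulAction ℕ+ (Pt E) where
  smul ν P := P.frob ν
  one_smul P := by
    change frob 1 P = P
    unfold frob
    congr 1
    exact MonoidHom.ext fun y => pow_one (P.char y)
  mul_smul μ ν P := by
    change frob (μ * ν) P = frob μ (frob ν P)
    unfold frob
    congr 1
    rw [PNat.mul_coe, mul_comm]
    exact MonoidHom.ext fun y => pow_mul (P.char y) ν μ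

/-- The value of a character at an element of the residue field, extended by `0 ↦ 0`. -/
def extendChar {X : Scheme.{u}} {x : X} (χ : ResidueChar x) (a : X.residueField x) : ℂ :=
  open Classical in if h : a = 0 then 0 else (χ (Units.mk0 a h) : ℂ)

/-- For an open `U` of `X₀` with preimage `Spec R` in the normalization, a point over `U`
viewed as the multiplicative map `R → ℂ`. -/
def eval (U : X₀.Opens) (P : {P : Pt E // normProj X₀ K P.pt ∈ U}) :
    Γ(normalizationIn X₀ K, normProj X₀ K ⁻¹ᵁ U) → ℂ :=
  fun r => extendChar P.1.char
    ((normalizationIn X₀ K).evaluation (normProj X₀ K ⁻¹ᵁ U) P.1.pt P.2 r)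

/-- A set is open if and only if, for every affine open `U` of `X₀`, its part over `U` is open for
the topology of pointwise convergence of the multiplicative maps `R → ℂ`. -/
instance : TopologicalSpace (Pt E) :=
  ⨆ U : X₀.affineOpens, TopologicalSpace.coinduced
    (Subtype.val : {P : Pt E // normProj X₀ K P.pt ∈ U.1} → Pt E)
    (TopologicalSpace.induced (eval U.1) Pi.topologicalSpace)

end Pt

/-- The quotient of the space of points by the Galois group. -/
def Pt₀ (E : CharCondition X₀ K) : Type u :=
  MulAction.orbitRel.Quotient (Gal(K/X₀.functionField))ᵐᵒᵖ (Pt E)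

namespace Pt₀

variable {E : CharCondition X₀ K}

/-- The Galois orbit of a point. -/
def mk (P : Pt E) : Pt₀ E :=
  Quotient.mk (MulAction.orbitRel (Gal(K/X₀.functionField))ᵐᵒᵖ (Pt E)) P

instance : TopologicalSpace (Pt₀ E) := TopologicalSpace.coinduced mk inferInstance

/-- The induced map `F_ν` on the quotient. -/
def frob (ν : ℕ+) : Pt₀ E → Pt₀ E :=
  Quotient.map (Pt.frob ν) (by rintro _ P ⟨σ, rfl⟩; exact ⟨σ, rfl⟩)

/-- The induced action of the positive integers on the quotient. -/
instance : MulAction ℕ+ (Pt₀ E) where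
  smul ν P := frob ν P
  one_smul P := by
    induction P using Quotient.inductionOn with
    | h P => exact congrArg mk (one_smul ℕ+ P)
  mul_smul μ ν P := by
    induction P using Quotient.inductionOn with
    | h P => exact congrArg mk (mul_smul μ ν P)

/-- The projection to `X₀`, sending the orbit of `(x, χ)` to the image of `x`. -/
def proj : Pt₀ E → X₀ :=
  Quotient.lift (fun P : Pt E => normProj X₀ K P.pt) (by
    rintro _ P ⟨σ, rfl⟩
    exact normProj_galMap X₀ σ.unop P.pt)

lemma proj_smul (ν : ℕ+) (P : Pt₀ E) : proj (ν • P) = proj P := by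
  induction P using Quotient.inductionOn with
  | h P => rfl

end Pt₀

end Points

section Colimit

/-- Equality in the colimit of copies of `Y` indexed by the positive integers `ν` ordered by
divisibility, the transition map from the copy `ν` to the copy `ν * μ` being the action
of `μ`: two elements become equal at a later stage. -/
def colimSetoid (Y : Type u) [MulAction ℕ+ Y] : Setoid (ℕ+ × Y) where
  r a b := ∃ μ : ℕ+, (μ * b.1) • a.2 = (μ * a.1) • b.2
  iseqv :=
    { refl := fun _ => ⟨1, rfl⟩
      symm := fun ⟨μ, h⟩ => ⟨μ, h.symm⟩
      trans := by
        rintro ⟨a, P⟩ ⟨b, Q⟩ ⟨c, R⟩ ⟨μ, h⟩ ⟨ν, k⟩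
        dsimp only at h k ⊢
        refine ⟨μ * ν * b, ?_⟩
        calc (μ * ν * b * c) • P = (ν * c) • (μ * b) • P := by
              rw [smul_smul]; congr 1; ac_rfl
          _ = (μ * a) • (ν * c) • Q := by
              rw [h, smul_smul, smul_smul, mul_comm]
          _ = (μ * ν * b * a) • R := by
              rw [k, smul_smul]; congr 1; ac_rfl }

/-- The colimit over the positive integers ordered by divisibility. -/
def Colim (Y : Type u) [MulAction ℕ+ Y] : Type u := Quotient (colimSetoid Y)

namespace Colim

variable {Y : Type u} [MulAction ℕ+ Y]

/-- The element of the colimit given by `P` in the copy with index `ν`, that is `F_ν⁻¹ (P)`. -/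
def mk (ν : ℕ+) (P : Y) : Colim Y := Quotient.mk (colimSetoid Y) (ν, P)

/-- The inductive limit topology, the finest one for which all the maps `mk ν` are continuous. -/
instance [TopologicalSpace Y] : TopologicalSpace (Colim Y) :=
  ⨆ ν : ℕ+, TopologicalSpace.coinduced (mk ν) inferInstance

/-- The numerator of a positive rational number. -/
def num (q : {q : ℚ // 0 < q}) : ℕ+ :=
  ⟨q.1.num.toNat, by have := Rat.num_pos.2 q.2; omega⟩

/-- The denominator of a positive rational number. -/
def den (q : {q : ℚ // 0 < q}) : ℕ+ := ⟨q.1.den, q.1.den_pos⟩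

lemma num_div_den (q : {q : ℚ // 0 < q}) : ((num q : ℕ) : ℚ) / (den q : ℕ) = q.1 := by
  have h : (((num q : ℕ) : ℤ) : ℚ) = q.1.num := by
    have := Rat.num_pos.2 q.2
    congr 1
    simp only [num, PNat.mk_coe]
    omega
  rw [Int.cast_natCast] at h
  rw [h]
  exact Rat.num_div_den q.1

lemma num_mul (q r : {q : ℚ // 0 < q}) :
    num (q * r) * (den q * den r) = den (q * r) * (num q * num r) := by
  have h := num_div_den (q * r)
  have hc : ((q * r : {q : ℚ // 0 < q}) : ℚ) = q.1 * r.1 := rfl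
  rw [hc, ← num_div_den q, ← num_div_den r] at h
  have h1 : ((den q : ℕ) : ℚ) ≠ 0 := by exact_mod_cast (den q).ne_zero
  have h2 : ((den r : ℕ) : ℚ) ≠ 0 := by exact_mod_cast (den r).ne_zero
  have h3 : ((den (q * r) : ℕ) : ℚ) ≠ 0 := by exact_mod_cast (den (q * r)).ne_zero
  field_simp at h
  apply PNat.coe_injective
  push_cast
  have h' : (num (q * r) : ℕ) * ((den q : ℕ) * (den r : ℕ)) =
      (den (q * r) : ℕ) * ((num q : ℕ) * (num r : ℕ)) := by
    have : ((num (q * r) : ℕ) : ℚ) * ((den q : ℕ) * (den r : ℕ)) =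
      (den (q * r) : ℕ) * ((num q : ℕ) * (num r : ℕ)) := by linear_combination h
    exact_mod_cast this
  exact h'

/-- The action of `q = a / b` in lowest terms: `F_q = F_a ∘ F_b⁻¹`, so `F_ν⁻¹ (P)` is sent to
`F_{b ν}⁻¹ (F_a (P))`. -/
def ratSmul (q : {q : ℚ // 0 < q}) : Colim Y → Colim Y :=
  Quotient.map (fun a : ℕ+ × Y => (den q * a.1, num q • a.2)) (by
    rintro ⟨a, P⟩ ⟨b, Q⟩ ⟨μ, h⟩
    refine ⟨μ, ?_⟩
    dsimp only at h ⊢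
    calc (μ * (den q * b)) • num q • P = (den q * num q) • (μ * b) • P := by
          rw [smul_smul, smul_smul]; congr 1; ac_rfl
      _ = (μ * (den q * a)) • num q • Q := by
          rw [h, smul_smul, smul_smul]; congr 1; ac_rfl)

/-- The positive rational numbers act on the colimit. -/
instance : MulAction {q : ℚ // 0 < q} (Colim Y) where
  smul q z := ratSmul q z
  one_smul z := by
    induction z using Quotient.inductionOn with
    | h a =>
      have h1 : num 1 = 1 := rfl
      have h2 : den 1 = 1 := rfl
      change Quotient.mk (colimSetoid Y) (den 1 * a.1, num 1 • a.2) = Quotient.mk _ a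
      rw [h1, h2, one_mul, one_smul]
  mul_smul q r z := by
    induction z using Quotient.inductionOn with
    | h a =>
      refine Quotient.sound ⟨1, ?_⟩
      dsimp only
      rw [one_mul, one_mul, smul_smul, smul_smul, smul_smul]
      congr 1
      have := num_mul q r
      calc den q * (den r * a.1) * num (q * r) = (num (q * r) * (den q * den r)) * a.1 := by ac_rfl
        _ = _ := by rw [this]; ac_rfl

end Colim

end Colimit

section Suspension

/-- The orbit relation of the action `q (P, u) = (q⁻¹ P, q u)` of the positive rational
numbers on `Z × ℝ_{>0}`. -/
def suspSetoid (Z : Type u) [MulAction {q : ℚ // 0 < q} Z] : Setoid (Z × {r : ℝ // 0 < r}) where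
  r a b := ∃ q : {q : ℚ // 0 < q}, b.1 = q⁻¹ • a.1 ∧ (b.2 : ℝ) = (q : ℚ) * (a.2 : ℝ)
  iseqv :=
    { refl := fun _ => ⟨1, by simp, by simp⟩
      symm := by
        rintro a b ⟨q, h, k⟩
        refine ⟨q⁻¹, by rw [h, inv_inv, smul_inv_smul], ?_⟩
        have hq : ((q : ℚ) : ℝ) ≠ 0 := by exact_mod_cast q.2.ne'
        have : (((q⁻¹ : {q : ℚ // 0 < q}) : ℚ) : ℝ) = ((q : ℚ) : ℝ)⁻¹ := by
          rw [Positive.coe_inv]; push_cast; rfl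
        rw [this, k, inv_mul_cancel_left₀ hq]
      trans := by
        rintro a b c ⟨q, h, k⟩ ⟨r, h', k'⟩
        refine ⟨r * q, by rw [h', h, smul_smul, mul_inv], ?_⟩
        rw [k', k, ← mul_assoc]
        congr 1
        have : ((r * q : {q : ℚ // 0 < q}) : ℚ) = r.1 * q.1 := rfl
        rw [this]; push_cast; rfl }

/-- The suspension `Z ×_{ℚ_{>0}} ℝ_{>0}`. -/
def Susp (Z : Type u) [MulAction {q : ℚ // 0 < q} Z] : Type u := Quotient (suspSetoid Z)

namespace Susp

variable {Z : Type u} [MulAction {q : ℚ // 0 < q} Z]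

/-- The class `[P, u]`. -/
def mk (P : Z) (u : {r : ℝ // 0 < r}) : Susp Z := Quotient.mk (suspSetoid Z) (P, u)

/-- The quotient topology of the product topology. -/
instance [TopologicalSpace Z] : TopologicalSpace (Susp Z) :=
  TopologicalSpace.coinduced (fun a : Z × {r : ℝ // 0 < r} => mk a.1 a.2) inferInstance

/-- The action of the positive real numbers, `[P, u] · v = [P, u v]`. -/
instance : MulAction {r : ℝ // 0 < r} (Susp Z) where
  smul v := Quotient.map (fun a => (a.1, a.2 * v)) (by
    rintro a b ⟨q, h, k⟩
    refine ⟨q, h, ?_⟩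
    rw [Positive.val_mul, Positive.val_mul, k, mul_assoc])
  one_smul z := by
    induction z using Quotient.inductionOn with
    | h a => exact congrArg (Quotient.mk _) (Prod.ext rfl (mul_one _))
  mul_smul v w z := by
    induction z using Quotient.inductionOn with
    | h a =>
      refine congrArg (Quotient.mk _) (Prod.ext rfl ?_)
      change a.2 * (v * w) = a.2 * w * v
      rw [mul_assoc, mul_comm v w]

/-- The flow `φ^t [P, u] = [P, u e^t]`. -/
def flow (t : ℝ) (z : Susp Z) : Susp Z := (⟨Real.exp t, Real.exp_pos t⟩ : {r : ℝ // 0 < r}) • z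

/-- `γ` is a periodic orbit of the flow, of length (least positive period) `ℓ`. -/
def IsPeriodicOrbit (γ : Set (Susp Z)) (ℓ : ℝ) : Prop :=
  0 < ℓ ∧ ∃ z, γ = Set.range (fun t => flow t z) ∧
    {t : ℝ | flow t z = z} = {t : ℝ | ∃ n : ℤ, t = n * ℓ}

end Susp

end Suspension

section System

variable {X₀ : Scheme.{u}} [AlgebraicGeometry.IsIntegral X₀]
  {K : Type u} [Field K] [Algebra X₀.functionField K]

/-- The projection of the colimit to `X₀`. -/
def colimProj {E : CharCondition X₀ K} : Colim (Pt₀ E) → X₀ :=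
  Quotient.lift (fun a => Pt₀.proj a.2) (by
    rintro ⟨a, P⟩ ⟨b, Q⟩ ⟨μ, h⟩
    have := congrArg Pt₀.proj h
    simpa only [Pt₀.proj_smul] using this)

/-- The phase space of the suspended flow. -/
abbrev PhaseSpace (E : CharCondition X₀ K) : Type u := Susp (Colim (Pt₀ E))

/-- The packet over `x₀`: the part of the phase space consisting of the `[P, u]` with `P` in the
fibre of the projection over `x₀`. -/
def packet (E : CharCondition X₀ K) (x₀ : X₀) : Set (PhaseSpace E) :=
  {z | ∃ (P : Colim (Pt₀ E)) (u : {r : ℝ // 0 < r}), colimProj P = x₀ ∧ z = Susp.mk P u}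

/-- The norm of a point: the number of elements of its residue field. -/
def pointNorm (x₀ : X₀) : ℕ := Nat.card (X₀.residueField x₀)

end System

end ArithDyn

end

/-! Isotropy reduces to an equation between characters: by `Susp.mem_stabilizer_mk_iff`, a number
`v` fixes `[F_ν⁻¹ y, u]` exactly when `v = a / b` with `F_a y = F_b y`. For `y` the Galois orbit of
`P = (x, χ)` this says `F_a P = (F_b P) ^ σ` for some `σ`, that is, `χ(r) ^ a = χ(σ r) ^ b` on
sections `r` near `x`.

If `x₀ = π(x)` is not closed, then `κ(x)ˣ` is not torsion, so some section `t` has a value `χ(t)`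
that is not a root of unity. As `t` is algebraic over the function field, `σ ^ m t = t` for some `m
> 0`. Iterating the relation gives `χ(t) ^ (a ^ m) = χ(t) ^ (b ^ m)`, hence `a = b` and the isotropy
is trivial (`Pt.eq_of_frob_eq_gal`).

If `x₀` is closed, then `κ(x₀)` is finite, `κ(x)` is algebraic over it and radicially closed, and
`χ` is a power of an injective character. The relation becomes `y ^ a = σ(y) ^ b` in `κ(x)`. Roots
of unity show that `a` and `b` have the same prime-to-`p` part, and the finite field `κ(x₀)`, fixed
by `σ`, shows that the remaining power of `p` is a power of `N x₀`
(`IsRadiciallyClosed.exists_zpow_of_pow_eq`). Conversely a Frobenius automorphism at `x` gives `F_N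
P = P ^ σ` (`Pt.exists_frob_pointNorm_eq_gal`).

A packet over a closed point is the image of (injective characters at one `x`) × `[1, N x₀]`. The
first factor is closed in a product of finite sets, whence compactness; Teichmüller lifts make it
nonempty. The statements on orbits follow by taking logarithms. -/

noncomputable section

namespace ArithDyn

/-! ### Radicially closed fields with torsion unit group, and their characters. -/

section TorsionFields

variable {F : Type u} [Field F]

lemma exists_prime_charP_of_isMulTorsion (hT : IsMulTorsion Fˣ) : ∃ p, p.Prime ∧ CharP F p := by
  obtain ⟨p, hp⟩ := CharP.exists F
  rcases CharP.char_is_prime_or_zero F p with h | rfl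
  · exact ⟨p, h, hp⟩
  have := CharP.charP_to_charZero F
  obtain ⟨n, hn, h⟩ := isOfFinOrder_iff_pow_eq_one.1 (hT (Units.mk0 (2 : F) two_ne_zero))
  have h2 : (2 : F) ^ n = 1 := by simpa using congrArg Units.val h
  have h3 : 2 ^ n = 1 := by exact_mod_cast h2
  exact absurd h3 (Nat.one_lt_two_pow hn.ne').ne'

lemma IsRadiciallyClosed.pow_surjective (hF : IsRadiciallyClosed F) {n : ℕ} (hn : 0 < n) :
    Function.Surjective (fun x : Fˣ => x ^ n) := by
  intro a
  obtain ⟨x, hx⟩ := (hF n hn a).exists_eval_eq_zero (by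
    rw [Polynomial.degree_X_pow_sub_C hn]
    exact_mod_cast hn.ne')
  have hx' : x ^ n = a := by simpa [sub_eq_zero] using hx
  have h0 : x ≠ 0 := by
    rintro rfl
    rw [zero_pow hn.ne'] at hx'
    exact a.ne_zero hx'.symm
  exact ⟨Units.mk0 x h0, Units.ext (by simpa using hx')⟩

lemma IsRadiciallyClosed.exists_isPrimitiveRoot (hF : IsRadiciallyClosed F) {n : ℕ} (hn : 0 < n)
    (h : (n : F) ≠ 0) : ∃ ζ : F, IsPrimitiveRoot ζ n := by
  have : NeZero (n : F) := ⟨h⟩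
  have hs : (Polynomial.cyclotomic n F).Splits := by
    have := hF n hn 1
    rw [Polynomial.C_1] at this
    exact this.of_dvd (Polynomial.monic_X_pow_sub_C (1 : F) hn.ne' |>.ne_zero)
      (Polynomial.cyclotomic.dvd_X_pow_sub_one n F)
  obtain ⟨ζ, hζ⟩ := hs.exists_eval_eq_zero (Polynomial.degree_cyclotomic_pos n F hn).ne'
  exact ⟨ζ, Polynomial.isRoot_cyclotomic_iff.1 hζ⟩

/-- A character with finite kernel of order `m` is the `m`-th power of an injective one. -/
lemma IsRadiciallyClosed.exists_injective_pow_eq (hF : IsRadiciallyClosed F) {H : Type*}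
    [CommGroup H] (χ : Fˣ →* H) (hχ : Finite χ.ker) :
    ∃ (χ₀ : Fˣ →* H) (m : ℕ), 0 < m ∧ Function.Injective χ₀ ∧ χ = χ₀ ^ m := by
  classical
  set m := Nat.card χ.ker with hm
  have hm0 : 0 < m := Nat.card_pos
  -- A subgroup of order `m` lies in `μ_m`, which has at most `m` elements, so the kernel is all of
  -- `μ_m`.
  have hker : ∀ y : Fˣ, y ∈ χ.ker ↔ y ^ m = 1 := by
    have : NeZero m := ⟨hm0.ne'⟩
    have hle : χ.ker ≤ rootsOfUnity m F := by
      intro y hy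
      rw [mem_rootsOfUnity]
      exact congrArg Subtype.val (pow_card_eq_one' (x := (⟨y, hy⟩ : χ.ker)))
    have hcard : Nat.card (rootsOfUnity m F) ≤ Nat.card χ.ker := by
      exact card_rootsOfUnity F m
    have := Subgroup.eq_of_le_of_card_ge hle hcard
    intro y
    rw [this, mem_rootsOfUnity]
  let f : Fˣ →* Fˣ := powMonoidHom m
  have hf : Function.Surjective f := hF.pow_surjective hm0
  have hle : f.ker ≤ χ.ker := fun y hy => (hker y).2 hy
  -- `y ↦ y ^ m` is onto with the same kernel as `χ`, so `χ` factors through it by an injective map.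
  let χ₀ : Fˣ →* H := f.liftOfSurjective hf ⟨χ, hle⟩
  have hχ₀ : ∀ y, χ₀ (y ^ m) = χ y := fun y =>
    MonoidHom.liftOfRightInverse_comp_apply f _ (Function.rightInverse_surjInv hf) ⟨χ, hle⟩ y
  refine ⟨χ₀, m, hm0, ?_, ?_⟩
  · rw [injective_iff_map_eq_one]
    intro x hx
    obtain ⟨y, rfl⟩ := hf x
    have : χ₀ (y ^ m) = 1 := hx
    rw [hχ₀] at this
    exact (hker y).1 this
  · ext y
    rw [MonoidHom.pow_apply, ← map_pow, hχ₀]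

/-- Teichmüller representatives embed `Fˣ` in `W(F)`. Their images are roots of unity, hence
algebraic over `ℚ`, and the algebraic closure of `ℚ` in `Frac W(F)` embeds in `ℂ`. -/
lemma exists_injective_monoidHom_complexUnits (hT : IsMulTorsion Fˣ) :
    ∃ χ : Fˣ →* ℂˣ, Function.Injective χ := by
  obtain ⟨p, hp, hc⟩ := exists_prime_charP_of_isMulTorsion hT
  have : Fact p.Prime := ⟨hp⟩
  let W := WittVector p F
  -- A prime characteristic of the domain `W(F)` would vanish in `F`, so it would be `p`; but `p ≠
  -- 0` in `W(F)`.
  have hW : CharZero W := by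
    obtain ⟨q, hq⟩ := CharP.exists W
    rcases CharP.char_is_prime_or_zero W q with h | rfl
    · have h0 : (q : F) = 0 := by
        rw [← map_natCast (WittVector.constantCoeff (p := p) (R := F)) q]
        exact (congrArg WittVector.constantCoeff (CharP.cast_eq_zero W q)).trans (map_zero _)
      rw [CharP.cast_eq_zero_iff F p, Nat.prime_dvd_prime_iff_eq hp h] at h0
      subst h0
      exact absurd (CharP.cast_eq_zero W p) (WittVector.p_nonzero p F)
    · exact CharP.charP_to_charZero W
  have hQ : CharZero (FractionRing W) :=
    charZero_of_injective_algebraMap (IsFractionRing.injective W (FractionRing W))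
  let A := algebraicClosure ℚ (FractionRing W)
  have : Algebra.IsAlgebraic ℚ A := algebraicClosure.isAlgebraic ℚ (FractionRing W)
  let j : A →ₐ[ℚ] ℂ := IsAlgClosed.lift
  let τ : F →* FractionRing W :=
    (algebraMap W (FractionRing W) : W →* FractionRing W).comp (WittVector.teichmuller p)
  have hτi : Function.Injective τ := by
    intro x y h
    have h' := IsFractionRing.injective W (FractionRing W) h
    have := congrArg (fun w : W => w.coeff 0) h'
    exact ((WittVector.teichmuller_coeff_zero p x).symm.trans this).trans
      (WittVector.teichmuller_coeff_zero p y)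
  have hτ : ∀ x : Fˣ, τ x ∈ A := by
    intro x
    obtain ⟨n, hn, h⟩ := isOfFinOrder_iff_pow_eq_one.1 (hT x)
    rw [mem_algebraicClosure_iff']
    refine IsIntegral.of_pow hn ?_
    rw [← map_pow, ← Units.val_pow_eq_pow_val, h, Units.val_one, map_one]
    exact isIntegral_one
  let ψ : Fˣ →* A :=
    { toFun := fun x => ⟨τ x, hτ x⟩
      map_one' := Subtype.ext (by simp)
      map_mul' := fun x y => Subtype.ext (by simp) }
  refine ⟨((j : A →* ℂ).comp ψ).toHomUnits, ?_⟩
  intro x y h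
  have h1 : j (ψ x) = j (ψ y) := congrArg Units.val h
  have h2 := j.toRingHom.injective h1
  exact Units.ext (hτi (congrArg Subtype.val h2))

/-- The injective characters of a torsion group form a compact set for the topology of pointwise
convergence. -/
lemma isCompact_injective_monoidHom {T : Type*} [CommGroup T] (hT : IsMulTorsion T) :
    IsCompact {g : T → ℂ | ∃ χ : T →* ℂˣ, Function.Injective χ ∧ g = fun a => (χ a : ℂ)} := by
  -- Each value ranges over a finite set, so excluding the value 1 at `a ≠ 1` keeps the set compact:
  -- injectivity becomes a closed condition.
  have hfin : ∀ a : T, {z : ℂ | z ^ orderOf a = 1 ∧ (a ≠ 1 → z ≠ 1)}.Finite := by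
    intro a
    have h0 : 0 < orderOf a := orderOf_pos_iff.2 (hT a)
    refine Set.Finite.subset (Polynomial.nthRoots (orderOf a) (1 : ℂ)).toFinset.finite_toSet ?_
    intro z hz
    simpa [Polynomial.mem_nthRoots h0] using hz.1
  have hK := isCompact_univ_pi fun a => (hfin a).isCompact
  have hC : IsClosed {g : T → ℂ | ∀ a b, g (a * b) = g a * g b} := by
    simp only [Set.ofPred_forall]
    exact isClosed_iInter fun a => isClosed_iInter fun b =>
      isClosed_eq (continuous_apply (a * b)) ((continuous_apply a).mul (continuous_apply b))
  convert hK.inter_right hC using 1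
  ext g
  constructor
  · rintro ⟨χ, hχ, rfl⟩
    refine ⟨fun a _ => ⟨?_, ?_⟩, fun a b => by simp⟩
    · rw [← Units.val_pow_eq_pow_val, ← map_pow, pow_orderOf_eq_one, map_one, Units.val_one]
    · intro ha h
      exact ha (hχ (by rw [map_one]; exact Units.ext h))
  · rintro ⟨h1, h2⟩
    have hg1 : g 1 = 1 := by simpa using (h1 1 trivial).1
    let f : T →* ℂ := { toFun := g, map_one' := hg1, map_mul' := h2 }
    refine ⟨f.toHomUnits, ?_, rfl⟩
    rw [injective_iff_map_eq_one]
    intro a ha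
    by_contra hne
    exact (h1 a trivial).2 hne (congrArg Units.val ha)

/-- If `x ^ a = σ x ^ b` holds in a radicially closed field with torsion units, where `σ` fixes a
finite subfield with `N` elements, then `a / b` is a power of `N`. -/
lemma IsRadiciallyClosed.exists_zpow_of_pow_eq (hF : IsRadiciallyClosed F) (hT : IsMulTorsion Fˣ)
    {k : Type u} [Field k] [Finite k] (i : k →+* F) (σ : F →+* F) (hσ : ∀ c, σ (i c) = i c)
    {a b : ℕ} (ha : 0 < a) (hb : 0 < b) (h : ∀ x : Fˣ, (x : F) ^ a = σ x ^ b) :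
    ∃ n : ℤ, (a : ℝ) / b = (Nat.card k : ℝ) ^ n := by
  obtain ⟨p, hp, hc⟩ := exists_prime_charP_of_isMulTorsion hT
  have : Fact p.Prime := ⟨hp⟩
  have hck : CharP k p := ⟨fun x => by
    rw [← CharP.cast_eq_zero_iff F p, ← map_natCast i, map_eq_zero]⟩
  obtain ⟨s, c, hpc, rfl⟩ := Nat.exists_eq_pow_mul_and_not_dvd ha.ne' p hp.ne_one
  obtain ⟨t, d, hpd, rfl⟩ := Nat.exists_eq_pow_mul_and_not_dvd hb.ne' p hp.ne_one
  have hc0 : 0 < c := Nat.pos_of_ne_zero (by rintro rfl; simp at hpc)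
  have hd0 : 0 < d := Nat.pos_of_ne_zero (by rintro rfl; simp at hpd)
  -- Test the relation on a primitive `c`-th root of unity, which exists since `p ∤ c`: it gives `c
  -- ∣ p ^ t * d`, and `c` is prime to `p`.
  have hcd : c ∣ d := by
    obtain ⟨ζ, hζ⟩ := hF.exists_isPrimitiveRoot hc0 (by rwa [Ne, CharP.cast_eq_zero_iff F p])
    have h0 : ζ ≠ 0 := hζ.ne_zero hc0.ne'
    have h1 := h (Units.mk0 ζ h0)
    rw [Units.val_mk0, mul_comm, pow_mul, hζ.pow_eq_one, one_pow, ← map_pow] at h1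
    have h2 : ζ ^ (p ^ t * d) = 1 := σ.injective (by rw [← h1, map_one])
    exact (Nat.Coprime.pow_right t ((hp.coprime_iff_not_dvd.2 hpc).symm)).dvd_of_dvd_mul_left
      (hζ.dvd_of_pow_eq_one _ h2)
  have hdc : d ∣ c := by
    obtain ⟨ζ, hζ⟩ := hF.exists_isPrimitiveRoot hd0 (by rwa [Ne, CharP.cast_eq_zero_iff F p])
    have h0 : ζ ≠ 0 := hζ.ne_zero hd0.ne'
    have h1 := h (Units.mk0 ζ h0)
    rw [Units.val_mk0, ← map_pow, mul_comm (p ^ t), pow_mul ζ d, hζ.pow_eq_one, one_pow,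
      map_one] at h1
    exact (Nat.Coprime.pow_right s ((hp.coprime_iff_not_dvd.2 hpd).symm)).dvd_of_dvd_mul_left
      (hζ.dvd_of_pow_eq_one _ h1)
  obtain rfl : c = d := Nat.dvd_antisymm hcd hdc
  -- Apply the relation to a `c`-th root `w` of `x` in `F`; since `w ^ c` comes from `k`, it is
  -- fixed by `σ`.
  have key : ∀ x : kˣ, x ^ p ^ s = x ^ p ^ t := by
    intro x
    obtain ⟨w, hw⟩ := hF.pow_surjective hc0 (Units.map (i : k →* F) x)
    have hw' : (w : F) ^ c = i x := congrArg Units.val hw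
    have h1 := h w
    rw [mul_comm, pow_mul, hw', mul_comm, pow_mul, ← map_pow σ, hw', hσ] at h1
    apply Units.ext
    apply i.injective
    simpa using h1
  have : Fintype k := Fintype.ofFinite k
  obtain ⟨f, -, hf⟩ := FiniteField.card k p
  have hN : Nat.card k = p ^ (f : ℕ) := by rw [Nat.card_eq_fintype_card, hf]
  -- Frobenius is injective, so `p ^ s` cancels and `x ^ p ^ l = x` on `k`. A generator of `kˣ` has
  -- order `p ^ f - 1`, which therefore divides `p ^ l - 1`; this forces `f ∣ l`.
  have aux : ∀ {s t : ℕ}, s ≤ t → (∀ x : kˣ, x ^ p ^ s = x ^ p ^ t) → ∃ e, t = s + f * e := by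
    intro s t hst hx
    obtain ⟨l, rfl⟩ := Nat.exists_eq_add_of_le hst
    have hx' : ∀ x : kˣ, x ^ (p ^ l - 1) = 1 := by
      intro x
      have h2 : (x : k) ^ p ^ s = ((x : k) ^ p ^ l) ^ p ^ s := by
        have := congrArg Units.val (hx x)
        rw [Units.val_pow_eq_pow_val, Units.val_pow_eq_pow_val] at this
        rw [this, ← pow_mul, pow_add, mul_comm]
      have h3 : (x : k) = (x : k) ^ p ^ l := iterateFrobenius_inj k p s (by
        simpa [iterateFrobenius_def] using h2)
      have h4 : x ^ p ^ l = x := Units.ext (by rw [Units.val_pow_eq_pow_val, ← h3])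
      have h5 : x ^ (p ^ l - 1) * x = x := by
        rw [← pow_succ, Nat.sub_add_cancel (Nat.one_le_pow _ _ hp.pos), h4]
      exact mul_eq_right.1 h5
    have hdvd : p ^ (f : ℕ) - 1 ∣ p ^ l - 1 := by
      obtain ⟨g, hg⟩ := IsCyclic.exists_ofOrder_eq_natCard (α := kˣ)
      rw [Nat.card_units, hN] at hg
      rw [← hg]
      exact orderOf_dvd_of_pow_eq_one (hx' g)
    have hgcd := Nat.pow_sub_one_gcd_pow_sub_one p f l
    rw [Nat.gcd_eq_left hdvd] at hgcd
    have hpw : p ^ (f : ℕ) = p ^ Nat.gcd f l := by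
      have h1 := Nat.one_le_pow (f : ℕ) p hp.pos
      have h2 := Nat.one_le_pow (Nat.gcd f l) p hp.pos
      omega
    have := Nat.pow_right_injective hp.two_le hpw
    obtain ⟨e, he⟩ := (this ▸ Nat.gcd_dvd_right f l : (f : ℕ) ∣ l)
    exact ⟨e, by rw [he]⟩
  have hp0 : (p : ℝ) ≠ 0 := by exact_mod_cast hp.ne_zero
  have hcr : (c : ℝ) ≠ 0 := by exact_mod_cast hc0.ne'
  rcases le_total s t with hst | hst
  · obtain ⟨e, he⟩ := aux hst key
    refine ⟨-e, ?_⟩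
    rw [hN, he]
    push_cast
    rw [zpow_neg, zpow_natCast, ← pow_mul, pow_add]
    field_simp
  · obtain ⟨e, he⟩ := aux hst fun x => (key x).symm
    refine ⟨e, ?_⟩
    rw [hN, he]
    push_cast
    rw [zpow_natCast, ← pow_mul, pow_add]
    field_simp

end TorsionFields

/-! ### Galois action on an integral closure: decomposition and Frobenius. -/

section IntegralClosure

/-- The polynomials `T ^ N - a` split over the integral closure of a ring in a radicially closed
field. -/
lemma IsRadiciallyClosed.splits_of_isIntegralClosure {A B : Type*} [CommRing A] [CommRing B]
    [Algebra A B] {L : Type u} [Field L] [Algebra A L] [Algebra B L] [IsScalarTower A B L]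
    [IsIntegralClosure B A L] (hL : IsRadiciallyClosed L) {n : ℕ} (hn : 0 < n) (b : B) :
    (Polynomial.X ^ n - Polynomial.C b : Polynomial B).Splits := by
  have hinj : Function.Injective (algebraMap B L) := IsIntegralClosure.algebraMap_injective B A L
  set f : Polynomial L := Polynomial.X ^ n - Polynomial.C (algebraMap B L b) with hf
  have hmon : f.Monic := Polynomial.monic_X_pow_sub_C _ hn.ne'
  have hs : f.Splits := hL n hn _
  -- The `n`-th power of a root is integral over `A`, so the root is integral as well and lies in
  -- `B`.
  have hroots : ∀ z ∈ f.roots, z ∈ Set.range (algebraMap B L) := by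
    intro z hz
    have hz' : z ^ n = algebraMap B L b := by
      have := (Polynomial.mem_roots'.1 hz).2
      simpa [hf, sub_eq_zero] using this
    have : IsIntegral A z := IsIntegral.of_pow hn (by
      rw [hz']
      exact (IsIntegralClosure.isIntegral A L b).algebraMap)
    exact (IsIntegralClosure.isIntegral_iff (A := B)).1 this
  choose! g hg using hroots
  have : (Polynomial.X ^ n - Polynomial.C b : Polynomial B) =
      ((f.roots.map g).map fun c => Polynomial.X - Polynomial.C c).prod := by
    apply Polynomial.map_injective _ hinj
    rw [Polynomial.map_multiset_prod, Multiset.map_map, Multiset.map_map]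
    have h1 : (Polynomial.X ^ n - Polynomial.C b : Polynomial B).map (algebraMap B L) = f := by
      simp [hf]
    rw [h1]
    conv_lhs => rw [hs.eq_prod_roots_of_monic hmon]
    congr 1
    refine Multiset.map_congr rfl fun z hz => ?_
    simp [hg z hz]
  rw [this]
  refine Submonoid.multiset_prod_mem _ _ ?_
  intro q hq
  obtain ⟨c, -, rfl⟩ := Multiset.mem_map.1 hq
  exact Polynomial.Splits.X_sub_C c

/-- The factorization of `T ^ n - b` holds over `B` itself, so it can be reduced modulo a maximal
ideal. This is how residue fields inherit radicial closedness. -/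
lemma IsRadiciallyClosed.of_surjective {A B : Type*} [CommRing A] [CommRing B]
    [Algebra A B] {L : Type u} [Field L] [Algebra A L] [Algebra B L] [IsScalarTower A B L]
    [IsIntegralClosure B A L] (hL : IsRadiciallyClosed L) {F : Type u} [Field F] (f : B →+* F)
    (hf : Function.Surjective f) : IsRadiciallyClosed F := by
  intro n hn a
  obtain ⟨b, rfl⟩ := hf a
  have := (hL.splits_of_isIntegralClosure (A := A) hn b).map f
  simpa using this

variable (A : Type*) {K L B : Type*} [CommRing A] [CommRing B] [Field K] [Field L]
  [Algebra B L] [Algebra K L] [Algebra A L] [hB : IsIntegralClosure B A L] (act : Gal(L/K) → B →+* B)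
  (hact : ∀ σ b, algebraMap B L (act σ b) = σ (algebraMap B L b))

include hB hact

/-- An algebraic element has finitely many conjugates, and an injective map is purely periodic on a
finite orbit. The exponent depends on `b`, as `σ` may have infinite order. -/
lemma exists_iterate_eq_self [Algebra.IsAlgebraic K L] (σ : Gal(L/K)) (b : B) :
    ∃ m, 0 < m ∧ (act σ)^[m] b = b := by
  have hinj : Function.Injective (algebraMap B L) := IsIntegralClosure.algebraMap_injective B A L
  set x := algebraMap B L b with hx
  have hit : ∀ m, algebraMap B L ((act σ)^[m] b) = (σ ^ m) x := by
    intro m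
    induction m with
    | zero => rfl
    | succ m ih => rw [Function.iterate_succ_apply', hact, ih, pow_succ']; rfl
  have hmem : ∀ m : ℕ, (σ ^ m) x ∈ (minpoly K x).rootSet L := by
    intro m
    rw [Polynomial.mem_rootSet]
    refine ⟨minpoly.ne_zero (Algebra.IsIntegral.isIntegral x), ?_⟩
    rw [Polynomial.aeval_algHom_apply (σ ^ m) x, minpoly.aeval, map_zero]
  obtain ⟨i, -, j, -, hij, h⟩ := Set.infinite_univ.exists_lt_map_eq_of_mapsTo
    (f := fun m : ℕ => (σ ^ m) x) (fun m _ => hmem m)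
    ((minpoly K x).rootSet_finite L)
  refine ⟨j - i, Nat.sub_pos_of_lt hij, hinj ?_⟩
  rw [hit]
  have h' : (σ ^ i) ((σ ^ (j - i)) x) = (σ ^ i) x := by
    rw [← AlgEquiv.mul_apply, ← pow_add, Nat.add_sub_cancel' hij.le]
    exact h.symm
  exact (σ ^ i).injective h'

lemma act_one (b : B) : act 1 b = b :=
  IsIntegralClosure.algebraMap_injective B A L (by rw [hact]; rfl)

lemma act_mul (σ τ : Gal(L/K)) (b : B) : act (σ * τ) b = act σ (act τ b) :=
  IsIntegralClosure.algebraMap_injective B A L (by rw [hact, hact, hact]; rfl)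

/-- The action of the Galois group on an integral closure that extends to the given one on the
field. -/
@[reducible]
def mulSemiringActionOfAct : MulSemiringAction Gal(L/K) B where
  smul σ b := act σ b
  one_smul := act_one A act hact
  mul_smul := act_mul A act hact
  smul_zero σ := map_zero (act σ)
  smul_add σ := map_add (act σ)
  smul_one σ := map_one (act σ)
  smul_mul σ := map_mul (act σ)

/-- Open stabilizers mean that the profinite group acts continuously on the discrete ring `B`, as
the theory of decomposition groups requires for infinite `L/K`. -/
lemma isOpen_setOf_act_eq [Algebra.IsAlgebraic K L] (b : B) : IsOpen {σ : Gal(L/K) | act σ b = b} := by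
  convert stabilizer_isOpen_of_isIntegral (K := K) (algebraMap B L b) using 1
  ext σ
  change act σ b = b ↔ σ (algebraMap B L b) = algebraMap B L b
  rw [← hact]
  exact (IsIntegralClosure.algebraMap_injective B A L).eq_iff.symm

variable [Algebra A K] [Algebra A B] [IsScalarTower A K L] [IsScalarTower A B L]

lemma act_algebraMap (σ : Gal(L/K)) (a : A) : act σ (algebraMap A B a) = algebraMap A B a :=
  IsIntegralClosure.algebraMap_injective B A L (by
    rw [hact, ← IsScalarTower.algebraMap_apply, IsScalarTower.algebraMap_apply A K L, σ.commutes])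

variable [IsFractionRing A K] [IsIntegrallyClosed A] [IsGalois K L]

/-- An invariant element lies in `K` and is integral over `A`. This is the place where normality of
the base is needed. -/
lemma exists_algebraMap_eq_of_act_eq (b : B) (hb : ∀ σ, act σ b = b) :
    ∃ a, algebraMap A B a = b := by
  have hfix : algebraMap B L b ∈ Set.range (algebraMap K L) :=
    (InfiniteGalois.mem_range_algebraMap_iff_fixed _).2 fun σ => by rw [← hact, hb]
  obtain ⟨k, hk⟩ := hfix
  have hint : IsIntegral A (algebraMap B L b) := (IsIntegralClosure.isIntegral A L b).algebraMap
  rw [← hk, isIntegral_algebraMap_iff (FaithfulSMul.algebraMap_injective K L)] at hint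
  obtain ⟨a, rfl⟩ := IsIntegrallyClosed.algebraMap_eq_of_integral hint
  refine ⟨a, IsIntegralClosure.algebraMap_injective B A L ?_⟩
  rw [← hk, ← IsScalarTower.algebraMap_apply, ← IsScalarTower.algebraMap_apply]

/-- The Galois group acts transitively on the primes of the integral closure over a given prime. -/
lemma exists_comap_act_eq (P Q : Ideal B) [P.IsPrime] [Q.IsPrime]
    (h : P.comap (algebraMap A B) = Q.comap (algebraMap A B)) :
    ∃ σ, Q = P.comap (act σ) := by
  let := mulSemiringActionOfAct A act hact
  have : SMulCommClass Gal(L/K) A B := ⟨fun σ a b => by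
    change act σ (a • b) = a • act σ b
    rw [Algebra.smul_def, map_mul, act_algebraMap A act hact, Algebra.smul_def]⟩
  have : Algebra.IsInvariant A B Gal(L/K) := ⟨exists_algebraMap_eq_of_act_eq A act hact⟩
  let : TopologicalSpace B := ⊥
  have : DiscreteTopology B := ⟨rfl⟩
  have : ContinuousSMul Gal(L/K) B :=
    continuousSMul_iff_stabilizer_isOpen.2 (isOpen_setOf_act_eq A act hact)
  obtain ⟨σ, hσ⟩ := Algebra.IsInvariant.exists_smul_of_under_eq_of_profinite (A := A)
    (G := Gal(L/K)) P Q h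
  refine ⟨σ⁻¹, ?_⟩
  rw [hσ, Ideal.pointwise_smul_eq_comap]
  rfl

/-- Frobenius automorphisms exist at the maximal ideals with finite residue field below. -/
lemma exists_act_sub_pow_mem (Q : Ideal B) [Q.IsMaximal]
    [Finite (A ⧸ Q.comap (algebraMap A B))] :
    ∃ σ, ∀ b, act σ b - b ^ Nat.card (A ⧸ Q.comap (algebraMap A B)) ∈ Q := by
  let := mulSemiringActionOfAct A act hact
  have : SMulCommClass Gal(L/K) A B := ⟨fun σ a b => by
    change act σ (a • b) = a • act σ b
    rw [Algebra.smul_def, map_mul, act_algebraMap A act hact, Algebra.smul_def]⟩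
  have : Algebra.IsInvariant A B Gal(L/K) := ⟨exists_algebraMap_eq_of_act_eq A act hact⟩
  let : TopologicalSpace B := ⊥
  have : DiscreteTopology B := ⟨rfl⟩
  have : ContinuousSMul Gal(L/K) B :=
    continuousSMul_iff_stabilizer_isOpen.2 (isOpen_setOf_act_eq A act hact)
  have hAB : Algebra.IsIntegral A B := IsIntegralClosure.isIntegral_algebra A L
  let P := Q.comap (algebraMap A B)
  have : P.IsMaximal := Ideal.isMaximal_comap_of_isIntegral_of_isMaximal Q
  let : Field (A ⧸ P) := Ideal.Quotient.field P
  let : Field (B ⧸ Q) := Ideal.Quotient.field Q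
  have : Q.LiesOver P := ⟨rfl⟩
  let : Fintype (A ⧸ P) := Fintype.ofFinite _
  have : Algebra.IsIntegral (A ⧸ P) (B ⧸ Q) := inferInstance
  have : Algebra.IsAlgebraic (A ⧸ P) (B ⧸ Q) := inferInstance
  -- The residue extension is algebraic over a finite field, so `y ↦ y ^ N` is an automorphism of it
  -- and lifts to the decomposition group.
  obtain ⟨σ, hσ⟩ := Ideal.Quotient.stabilizerHom_surjective_of_profinite (G := Gal(L/K)) P Q
    (FiniteField.frobeniusAlgEquivOfAlgebraic (A ⧸ P) (B ⧸ Q))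
  refine ⟨σ, fun b => ?_⟩
  rw [← Ideal.Quotient.eq, map_pow, Nat.card_eq_fintype_card]
  exact DFunLike.congr_fun hσ (Ideal.Quotient.mk Q b)

end IntegralClosure

/-! ### Over an affine open set, the normalization is an integral closure in `K`. -/

section Charts

variable {X₀ : Scheme.{u}} [AlgebraicGeometry.IsIntegral X₀]
  {K : Type u} [Field K] [Algebra X₀.functionField K] (U : X₀.Opens)

section

variable (X₀ K)

lemma genericMap_apply (z : Spec (.of K)) : genericMap X₀ K z = genericPoint X₀ := by
  unfold genericMap
  rw [Scheme.Hom.comp_apply]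
  have h : Spec.map (CommRingCat.ofHom (algebraMap X₀.functionField K)) z =
      IsLocalRing.closedPoint X₀.functionField := Subsingleton.elim _ _
  rw [h, Scheme.fromSpecStalk_closedPoint]

end

lemma genericPoint_mem [h : Nonempty U] : genericPoint X₀ ∈ U :=
  ((genericPoint_spec X₀).mem_open_set_iff U.isOpen).2 (by simpa using h)

lemma genericMap_preimage_eq_top [Nonempty U] : genericMap X₀ K ⁻¹ᵁ U = ⊤ :=
  top_le_iff.1 fun z _ => by
    change genericMap X₀ K z ∈ U
    rw [genericMap_apply]
    exact genericPoint_mem U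

lemma top_le_toNormalization_preimage [Nonempty U] :
    ⊤ ≤ (genericMap X₀ K).toNormalization ⁻¹ᵁ (normProj X₀ K ⁻¹ᵁ U) := by
  rw [← Scheme.Hom.comp_preimage, Scheme.Hom.toNormalization_fromNormalization,
    genericMap_preimage_eq_top]

lemma appLE_congr_hom {X Y : Scheme.{u}} {f g : X ⟶ Y} (h : f = g) {U : Y.Opens} {V : X.Opens}
    (e : V ≤ f ⁻¹ᵁ U) : f.appLE U V e = g.appLE U V (h ▸ e) := by
  subst h; rfl

/-- The sections of the normalization over a nonempty open set, as elements of the field `K`. -/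
def sectionsToField [Nonempty U] : Γ(normalizationIn X₀ K, normProj X₀ K ⁻¹ᵁ U) ⟶ .of K :=
  (genericMap X₀ K).toNormalization.appLE (normProj X₀ K ⁻¹ᵁ U) ⊤
    (top_le_toNormalization_preimage U) ≫ (Scheme.ΓSpecIso (.of K)).hom

/-- The action of the Galois group on the sections of the normalization. -/
def galSections (σ : Gal(K/X₀.functionField)) :
    Γ(normalizationIn X₀ K, normProj X₀ K ⁻¹ᵁ U) ⟶ Γ(normalizationIn X₀ K, normProj X₀ K ⁻¹ᵁ U) :=
  (galMap X₀ σ).appLE _ _ (by rw [← Scheme.Hom.comp_preimage, galMap_normProj])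

/-- This provides the hypothesis `hact` of the results on integral closures. -/
lemma sectionsToField_galSections [Nonempty U] (σ : Gal(K/X₀.functionField))
    (r : Γ(normalizationIn X₀ K, normProj X₀ K ⁻¹ᵁ U)) :
    sectionsToField U (galSections U σ r) = σ (sectionsToField U r) := by
  have h : galSections U σ ≫ sectionsToField U =
      sectionsToField U ≫ CommRingCat.ofHom (σ : K →+* K) := by
    unfold galSections sectionsToField
    rw [Category.assoc, ← Scheme.ΓSpecIso_naturality, ← Category.assoc, ← Category.assoc]
    congr 1
    refine (Scheme.Hom.appLE_comp_appLE _ _ _ _ _ _ _).trans ?_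
    refine (appLE_congr_hom (toNormalization_galMap X₀ σ) _).trans ?_
    refine (Scheme.Hom.appLE_comp_appLE _ _ _ ⊤ ⊤ (top_le_toNormalization_preimage U) le_top).symm.trans ?_
    exact congrArg (_ ≫ ·) (Scheme.Hom.appLE_eq_app (specGal X₀ σ))
  exact congr($h r)

instance (priority := low) sectionsAlgebra : Algebra Γ(X₀, U)
    Γ(normalizationIn X₀ K, normProj X₀ K ⁻¹ᵁ U) :=
  ((normProj X₀ K).app U).hom.toAlgebra

instance (priority := low) sectionsFieldAlgebra [Nonempty U] :
    Algebra Γ(normalizationIn X₀ K, normProj X₀ K ⁻¹ᵁ U) K :=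
  (sectionsToField U).hom.toAlgebra

instance (priority := low) baseFieldAlgebra [Nonempty U] : Algebra Γ(X₀, U) K :=
  ((algebraMap X₀.functionField K).comp (X₀.germToFunctionField U).hom).toAlgebra

instance [Nonempty U] : IsScalarTower Γ(X₀, U) X₀.functionField K :=
  .of_algebraMap_eq' rfl

lemma genericMap_appLE [Nonempty U] :
    (genericMap X₀ K).appLE U ⊤ (genericMap_preimage_eq_top U).ge ≫
      (Scheme.ΓSpecIso (.of K)).hom = CommRingCat.ofHom (algebraMap Γ(X₀, U) K) := by
  have h : ⊤ ≤ X₀.fromSpecStalk (genericPoint X₀) ⁻¹ᵁ U := fun z _ => by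
    change X₀.fromSpecStalk (genericPoint X₀) z ∈ U
    have hz : z = IsLocalRing.closedPoint X₀.functionField :=
      Subsingleton.elim (α := PrimeSpectrum X₀.functionField) _ _
    rw [hz, Scheme.fromSpecStalk_closedPoint]
    exact genericPoint_mem U
  have h1 : (genericMap X₀ K).appLE U ⊤ (genericMap_preimage_eq_top U).ge =
      (X₀.fromSpecStalk (genericPoint X₀)).appLE U ⊤ h ≫
      (Spec.map (CommRingCat.ofHom (algebraMap X₀.functionField K))).appTop :=
    (Scheme.Hom.appLE_comp_appLE _ _ _ ⊤ ⊤ h le_top).symm.trans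
      (congrArg (_ ≫ ·) (Scheme.Hom.appLE_eq_app _))
  rw [h1, Category.assoc]
  refine (congrArg (_ ≫ ·) (Scheme.ΓSpecIso_naturality _)).trans ?_
  have h2 : (X₀.fromSpecStalk (genericPoint X₀)).appLE U ⊤ h =
      X₀.germToFunctionField U ≫ (Scheme.ΓSpecIso _).inv := by
    unfold Scheme.Hom.appLE
    rw [Scheme.fromSpecStalk_app (genericPoint_mem U), Category.assoc, Category.assoc,
      ← Functor.map_comp]
    refine (congrArg (_ ≫ _ ≫ ·) (CategoryTheory.Functor.map_id _ _)).trans ?_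
    rw [Category.comp_id]
  rw [h2, Category.assoc, Iso.inv_hom_id_assoc]
  rfl

instance [Nonempty U] : IsScalarTower Γ(X₀, U)
    Γ(normalizationIn X₀ K, normProj X₀ K ⁻¹ᵁ U) K := by
  refine .of_algebraMap_eq' ?_
  have : CommRingCat.ofHom (algebraMap Γ(X₀, U) K) =
      (normProj X₀ K).app U ≫ sectionsToField U := by
    rw [← genericMap_appLE]
    unfold sectionsToField
    rw [← Category.assoc]
    congr 1
    rw [← Scheme.Hom.appLE_eq_app]
    refine Eq.trans ?_ (Scheme.Hom.appLE_comp_appLE _ _ _ _ _ _ _).symm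
    exact appLE_congr_hom (Scheme.Hom.toNormalization_fromNormalization _).symm _
  exact congrArg CommRingCat.Hom.hom this

/-- By construction the sections are the integral closure in the sections over the preimage of `U`
in `Spec K`. That preimage contains the only point, so the ambient ring is `K`. -/
lemma isIntegralClosure_sections [Nonempty U] (hU : IsAffineOpen U) :
    IsIntegralClosure Γ(normalizationIn X₀ K, normProj X₀ K ⁻¹ᵁ U) Γ(X₀, U) K := by
  let f := genericMap X₀ K
  let : Algebra Γ(X₀, U) Γ(Spec (.of K), f ⁻¹ᵁ U) := (f.app U).hom.toAlgebra
  have hle : (⊤ : (Spec (.of K)).Opens) ≤ f ⁻¹ᵁ U := (genericMap_preimage_eq_top U).ge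
  let e : Γ(Spec (.of K), f ⁻¹ᵁ U) ≅ .of K :=
    (Spec (.of K)).presheaf.mapIso (eqToIso (genericMap_preimage_eq_top U).symm).op ≪≫
      Scheme.ΓSpecIso (.of K)
  have he : ∀ a : Γ(X₀, U), e.hom (f.app U a) = algebraMap Γ(X₀, U) K a := by
    intro a
    have h : f.app U ≫ e.hom = CommRingCat.ofHom (algebraMap Γ(X₀, U) K) := by
      rw [← genericMap_appLE]
      change f.app U ≫ (Spec (.of K)).presheaf.map (eqToHom (genericMap_preimage_eq_top U).symm).op ≫
        _ = _
      rw [← Category.assoc]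
      congr 1
    exact congr($h a)
  let e' : Γ(Spec (.of K), f ⁻¹ᵁ U) ≃ₐ[Γ(X₀, U)] K :=
    AlgEquiv.ofRingEquiv (f := e.commRingCatIsoToRingEquiv) he
  have hval : ∀ r : Γ(normalizationIn X₀ K, normProj X₀ K ⁻¹ᵁ U),
      sectionsToField U r = e' ((f.normalizationObjIso hU).hom r).1 := by
    intro r
    have h : sectionsToField U = (f.normalizationObjIso hU).hom ≫
        CommRingCat.ofHom (Subalgebra.val _).toRingHom ≫ e.hom := by
      rw [← Category.assoc, f.normalizationObjIso_hom_val hU]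
      unfold sectionsToField
      change _ = _ ≫ (Spec (.of K)).presheaf.map (eqToHom (genericMap_preimage_eq_top U).symm).op ≫ _
      rw [← Category.assoc, Scheme.Hom.appLE_map]
    exact congr($h r)
  constructor
  · intro r s hrs
    have h : sectionsToField U r = sectionsToField U s := hrs
    rw [hval, hval] at h
    have h' := Subtype.ext (e'.injective h)
    exact (f.normalizationObjIso hU).commRingCatIsoToRingEquiv.injective h'
  · intro z
    obtain ⟨s, rfl⟩ := e'.surjective z
    rw [isIntegral_algEquiv e']
    constructor
    · intro hs
      refine ⟨(f.normalizationObjIso hU).inv ⟨s, hs⟩, ?_⟩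
      change sectionsToField U _ = _
      rw [hval]
      congr 2
      exact congrArg Subtype.val
        ((f.normalizationObjIso hU).commRingCatIsoToRingEquiv.apply_symm_apply ⟨s, hs⟩)
    · rintro ⟨r, hr⟩
      change sectionsToField U r = _ at hr
      rw [hval] at hr
      rw [← e'.injective hr]
      exact ((f.normalizationObjIso hU).hom r).2

end Charts

/-! ### Fields of finite type over `ℤ`. -/

instance isJacobsonRing_int : IsJacobsonRing ℤ := by
  refine isJacobsonRing_iff_prime_eq.2 fun P hP => ?_
  by_cases h : P = ⊥
  · subst h
    refine le_antisymm (fun x hx => ?_) Ideal.le_jacobson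
    -- For `x` in the radical, `x * x + 1` is a unit, hence `±1`, which leaves only `x = 0`.
    have hu := Int.isUnit_iff.1 (Ideal.mem_jacobson_bot.1 hx x)
    rw [Ideal.mem_bot]
    rcases hu with hu | hu <;> nlinarith
  · exact Ideal.jacobson_eq_self_of_isMaximal (H := hP.isMaximal h)

/-- By the Nullstellensatz over the Jacobson ring `ℤ`, `k` is a finite `ℤ`-module. In characteristic
zero `k` would be an integral extension of `ℤ`, making `ℤ` a field. -/
lemma finite_of_finiteType_int (k : Type*) [Field k] (h : (Int.castRingHom k).FiniteType) :
    Finite k := by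
  have h' : Algebra.FiniteType ℤ k := by
    have e : (Int.castRingHom k) = algebraMap ℤ k := Subsingleton.elim _ _
    rw [e] at h
    exact (RingHom.finiteType_algebraMap).1 h
  have : Module.Finite ℤ k := finite_of_finite_type_of_isJacobsonRing ℤ k
  obtain ⟨p, hp⟩ := CharP.exists k
  rcases CharP.char_is_prime_or_zero k p with h | rfl
  · have : Fact p.Prime := ⟨h⟩
    let : Algebra (ZMod p) k := ZMod.algebra k p
    have : Module.Finite (ZMod p) k := Module.Finite.of_restrictScalars_finite ℤ (ZMod p) k
    exact Module.finite_of_finite (ZMod p)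
  · have := CharP.charP_to_charZero k
    exact absurd (isField_of_isIntegral_of_isField (R := ℤ) (S := k)
      (algebraMap ℤ k).injective_int (Field.toIsField k)) Int.not_isField

/-! ### Values of sections in residue fields; closed points. -/

section Evaluation

lemma exists_isAffineOpen_mem {X : Scheme.{u}} (x : X) : ∃ U : X.Opens, IsAffineOpen U ∧ x ∈ U := by
  obtain ⟨_, ⟨U : X.Opens, hU, rfl⟩, hxU, -⟩ :=
    X.isBasis_affineOpens.exists_subset_of_mem_open (Set.mem_univ x) isOpen_univ
  exact ⟨U, hU, hxU⟩

variable {X : Scheme.{u}} {U : X.Opens}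

lemma primeIdealOf_asIdeal (hU : IsAffineOpen U) {x : X} (hx : x ∈ U) :
    (hU.primeIdealOf ⟨x, hx⟩).asIdeal = RingHom.ker (X.evaluation U x hx).hom := by
  rw [hU.primeIdealOf_eq_map_closedPoint]
  ext r
  rw [RingHom.mem_ker]
  exact (Ideal.Quotient.eq_zero_iff_mem (I := IsLocalRing.maximalIdeal (X.presheaf.stalk x))
    (a := X.presheaf.germ U x hx r)).symm

lemma eq_of_ker_evaluation_eq (hU : IsAffineOpen U) {x y : X} (hx : x ∈ U) (hy : y ∈ U)
    (h : RingHom.ker (X.evaluation U x hx).hom = RingHom.ker (X.evaluation U y hy).hom) :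
    x = y := by
  rw [← primeIdealOf_asIdeal hU, ← primeIdealOf_asIdeal hU] at h
  have := congrArg hU.fromSpec (PrimeSpectrum.ext h)
  rwa [hU.fromSpec_primeIdealOf, hU.fromSpec_primeIdealOf] at this

/-- Elements of the residue field are fractions of values of sections over an affine open. -/
lemma exists_mul_evaluation_eq (hU : IsAffineOpen U) {x : X} (hx : x ∈ U) (a : X.residueField x) :
    ∃ r s : Γ(X, U), X.evaluation U x hx s ≠ 0 ∧
      a * X.evaluation U x hx s = X.evaluation U x hx r := by
  obtain ⟨b, rfl⟩ := X.residue_surjective x a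
  let := X.presheaf.algebra_section_stalk ⟨x, hx⟩
  have := hU.isLocalization_stalk ⟨x, hx⟩
  obtain ⟨⟨r, s⟩, h⟩ := IsLocalization.surj (hU.primeIdealOf ⟨x, hx⟩).asIdeal.primeCompl b
  refine ⟨r, s, fun h0 => s.2 ?_, ?_⟩
  · have h1 : s.1 ∈ RingHom.ker (X.evaluation U x hx).hom := h0
    rwa [← primeIdealOf_asIdeal hU] at h1
  · exact (map_mul (X.residue x).hom b _).symm.trans (congrArg (X.residue x) h)

lemma evaluation_surjective_of_isMaximal (hU : IsAffineOpen U) {x : X} (hx : x ∈ U)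
    (h : (RingHom.ker (X.evaluation U x hx).hom).IsMaximal) :
    Function.Surjective (X.evaluation U x hx) := by
  intro a
  obtain ⟨r, s, hs, ha⟩ := exists_mul_evaluation_eq hU hx a
  obtain ⟨t, i, hi, ht⟩ := h.exists_inv (x := s) hs
  have h1 : X.evaluation U x hx t * X.evaluation U x hx s = 1 := by
    have := congrArg (X.evaluation U x hx) ht
    rwa [map_add, map_mul, map_one, show X.evaluation U x hx i = 0 from hi, add_zero] at this
  refine ⟨r * t, ?_⟩
  rw [map_mul, ← ha, mul_assoc, mul_comm (X.evaluation U x hx s), h1, mul_one]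

lemma isMaximal_ker_evaluation (hU : IsAffineOpen U) {x : X} (hx : x ∈ U) (h : IsClosed {x}) :
    (RingHom.ker (X.evaluation U x hx).hom).IsMaximal := by
  rw [← primeIdealOf_asIdeal hU]
  exact hU.primeIdealOf_isMaximal_of_isClosed ⟨x, hx⟩ h

/-- If `r` does not vanish at `x`, its value is a root of unity, so some `1 - r ^ n` is in the
kernel and a larger ideal containing `r` contains 1. -/
lemma isMaximal_ker_evaluation_of_isMulTorsion {x : X} (hx : x ∈ U)
    (h : IsMulTorsion (X.residueField x)ˣ) : (RingHom.ker (X.evaluation U x hx).hom).IsMaximal := by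
  refine Ideal.isMaximal_iff.2 ⟨fun h1 => RingHom.ker_ne_top (X.evaluation U x hx).hom
    ((Ideal.eq_top_iff_one _).2 h1), fun J r hJ hr hrJ => ?_⟩
  have hr0 : X.evaluation U x hx r ≠ 0 := hr
  obtain ⟨n, hn, hpow⟩ := isOfFinOrder_iff_pow_eq_one.1 (h (Units.mk0 _ hr0))
  have hpow' : (X.evaluation U x hx r) ^ n = 1 := by simpa using congrArg Units.val hpow
  have h1 : 1 - r ^ n ∈ J := hJ (by
    rw [RingHom.mem_ker]
    change X.evaluation U x hx (1 - r ^ n) = 0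
    rw [map_sub, map_one, map_pow, hpow', sub_self])
  have := J.add_mem h1 (J.pow_mem_of_mem hrJ n hn)
  rwa [sub_add_cancel] at this

/-- In an affine neighbourhood of a specialization `y` of `x`, the kernel at `x` is contained in the
kernel at `y`; being maximal, it is equal to it, so `x = y`. -/
lemma isClosed_singleton_of_isMulTorsion {x : X} (h : IsMulTorsion (X.residueField x)ˣ) :
    IsClosed {x} := by
  refine isClosed_of_closure_subset fun y hy => ?_
  obtain ⟨U, hU, hyU⟩ := exists_isAffineOpen_mem y
  have hs : x ⤳ y := specializes_iff_mem_closure.2 hy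
  have hxU : x ∈ U := hs.mem_open U.2 hyU
  have hle : RingHom.ker (X.evaluation U x hxU).hom ≤ RingHom.ker (X.evaluation U y hyU).hom := by
    intro r hr
    by_contra hne
    have h1 : y ∈ X.basicOpen r := (X.evaluation_ne_zero_iff_mem_basicOpen y hyU r).1 hne
    have h2 : x ∈ X.basicOpen r := hs.mem_open (X.basicOpen r).2 h1
    exact (X.evaluation_ne_zero_iff_mem_basicOpen x hxU r).2 h2 hr
  have heq := (isMaximal_ker_evaluation_of_isMulTorsion hxU h).eq_of_le
    (RingHom.ker_ne_top _) hle
  exact (eq_of_ker_evaluation_eq hU hxU hyU heq).symm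

lemma finite_residueField_of_isClosed [LocallyOfFiniteType (specULiftZIsTerminal.{u}.from X)]
    {x : X} (h : IsClosed {x}) : Finite (X.residueField x) := by
  obtain ⟨U, hU, hxU⟩ := exists_isAffineOpen_mem x
  have hs := evaluation_surjective_of_isMaximal hU hxU (isMaximal_ker_evaluation hU hxU h)
  let f := specULiftZIsTerminal.{u}.from X
  have h1 := f.finiteType_appLE (isAffineOpen_top _) hU (show U ≤ f ⁻¹ᵁ ⊤ from le_top)
  have h2 : ((X.evaluation U x hxU).hom).FiniteType := RingHom.FiniteType.of_surjective _ hs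
  let e : ℤ ≃+* Γ(Spec (.of (ULift.{u} ℤ)), ⊤) :=
    ULift.ringEquiv.symm.trans (Scheme.ΓSpecIso (.of (ULift.{u} ℤ))).symm.commRingCatIsoToRingEquiv
  have h3 := (h2.comp h1).comp (RingHom.FiniteType.of_surjective (e : ℤ →+* _) e.surjective)
  refine finite_of_finiteType_int _ ?_
  have e' : Int.castRingHom (X.residueField x) = ((X.evaluation U x hxU).hom.comp
      (f.appLE ⊤ U le_top).hom).comp (e : ℤ →+* _) := RingHom.ext_int _ _
  rw [e']
  exact h3

lemma isIntegrallyClosed_sections [AlgebraicGeometry.IsIntegral X]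
    (hn : ∀ x : X, IsIntegrallyClosed (X.presheaf.stalk x)) (hU : IsAffineOpen U) [Nonempty U] :
    IsIntegrallyClosed Γ(X, U) := by
  refine IsIntegrallyClosed.of_localization_maximal fun P hP hPm => ?_
  let y : PrimeSpectrum Γ(X, U) := ⟨P, hPm.isPrime⟩
  have hy : hU.fromSpec y ∈ U := by
    have : hU.fromSpec y ∈ Set.range hU.fromSpec := ⟨y, rfl⟩
    rwa [hU.range_fromSpec] at this
  let alg : Algebra Γ(X, U) (X.presheaf.stalk (hU.fromSpec y)) :=
    X.presheaf.algebra_section_stalk ⟨hU.fromSpec y, hy⟩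
  have hloc : IsLocalization P.primeCompl (X.presheaf.stalk (hU.fromSpec y)) :=
    hU.isLocalization_stalk' y hy
  have := hn (hU.fromSpec y)
  exact IsIntegrallyClosed.of_equiv (IsLocalization.algEquiv P.primeCompl
    (X.presheaf.stalk (hU.fromSpec y)) (Localization.AtPrime P)).toRingEquiv

end Evaluation

/-- The nonzero elements of an integral extension of a finite field are roots of unity. -/
lemma isMulTorsion_units_of_isIntegral {k F : Type*} [Field k] [Finite k] [Field F] (i : k →+* F)
    (h : i.IsIntegral) : IsMulTorsion Fˣ := by
  let := i.toAlgebra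
  intro a
  have ha : IsIntegral k (a : F) := h a
  have : Module.Finite k (Algebra.adjoin k {(a : F)}) :=
    Module.Finite.iff_fg.2 ha.fg_adjoin_singleton
  have : Finite (Algebra.adjoin k {(a : F)}) := Module.finite_of_finite k
  by_contra hinf
  rw [← injective_pow_iff_not_isOfFinOrder] at hinf
  have hinj : Function.Injective fun n : ℕ =>
      (⟨(a : F) ^ n, Subalgebra.pow_mem _ (Algebra.self_mem_adjoin_singleton k (a : F)) n⟩ :
        Algebra.adjoin k {(a : F)}) := by
    intro m n hmn
    refine hinf (Units.ext ?_)
    simpa using congrArg Subtype.val hmn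
  exact not_injective_infinite_finite _ hinj

/-! ### Points as multiplicative maps on sections. -/

section Points

variable {X₀ : Scheme.{u}} [AlgebraicGeometry.IsIntegral X₀]
  {K : Type u} [Field K] [Algebra X₀.functionField K] {U : X₀.Opens}

lemma galMap_mem {x : normalizationIn X₀ K} (hx : x ∈ normProj X₀ K ⁻¹ᵁ U)
    (σ : Gal(K/X₀.functionField)) : galMap X₀ σ x ∈ normProj X₀ K ⁻¹ᵁ U := by
  change normProj X₀ K (galMap X₀ σ x) ∈ U
  rw [normProj_galMap]
  exact hx

lemma residueFieldMap_galMap_evaluation {x : normalizationIn X₀ K}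
    (hx : x ∈ normProj X₀ K ⁻¹ᵁ U) (σ : Gal(K/X₀.functionField))
    (r : Γ(normalizationIn X₀ K, normProj X₀ K ⁻¹ᵁ U)) :
    (galMap X₀ σ).residueFieldMap x
      ((normalizationIn X₀ K).evaluation (normProj X₀ K ⁻¹ᵁ U) _ (galMap_mem hx σ) r) =
      (normalizationIn X₀ K).evaluation (normProj X₀ K ⁻¹ᵁ U) x hx (galSections U σ r) := by
  rw [Scheme.evaluation_naturality_apply]
  unfold galSections Scheme.Hom.appLE Scheme.evaluation
  simp only [CommRingCat.comp_apply]
  congr 1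
  exact (TopCat.Presheaf.germ_res_apply _ _ _ _ _).symm

/-- The values at a point of `X₀` and at a point of the normalization above it. -/
lemma residueFieldMap_normProj_evaluation {x : normalizationIn X₀ K}
    (hx : x ∈ normProj X₀ K ⁻¹ᵁ U) (a : Γ(X₀, U)) :
    (normProj X₀ K).residueFieldMap x (X₀.evaluation U (normProj X₀ K x) hx a) =
      (normalizationIn X₀ K).evaluation (normProj X₀ K ⁻¹ᵁ U) x hx
        (algebraMap Γ(X₀, U) _ a) :=
  Scheme.evaluation_naturality_apply _ _ hx a

lemma comap_ker_evaluation {x : normalizationIn X₀ K} (hx : x ∈ normProj X₀ K ⁻¹ᵁ U) :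
    (RingHom.ker ((normalizationIn X₀ K).evaluation (normProj X₀ K ⁻¹ᵁ U) x hx).hom).comap
      (algebraMap Γ(X₀, U) _) = RingHom.ker (X₀.evaluation U (normProj X₀ K x) hx).hom := by
  ext a
  rw [Ideal.mem_comap, RingHom.mem_ker, RingHom.mem_ker]
  refine Iff.trans (Eq.congr_left (residueFieldMap_normProj_evaluation hx a).symm) ?_
  exact map_eq_zero ((normProj X₀ K).residueFieldMap x).hom

namespace Pt

lemma extendChar_eq_zero_iff {X : Scheme.{u}} {x : X} (χ : ResidueChar x) (a : X.residueField x) :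
    extendChar χ a = 0 ↔ a = 0 := by
  unfold extendChar
  split_ifs with h <;> simp [h]

lemma extendChar_of_ne {X : Scheme.{u}} {x : X} (χ : ResidueChar x) {a : X.residueField x}
    (h : a ≠ 0) : extendChar χ a = χ (Units.mk0 a h) := dif_neg h

lemma extendChar_unit {X : Scheme.{u}} {x : X} (χ : ResidueChar x) (a : (X.residueField x)ˣ) :
    extendChar χ a = χ a := by
  rw [extendChar_of_ne χ a.ne_zero, Units.mk0_val]

lemma extendChar_pow {X : Scheme.{u}} {x : X} (χ : ResidueChar x) {n : ℕ} (hn : n ≠ 0)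
    (a : X.residueField x) : extendChar (χ ^ n) a = extendChar χ a ^ n := by
  by_cases h : a = 0
  · rw [(extendChar_eq_zero_iff _ _).2 h, (extendChar_eq_zero_iff _ _).2 h, zero_pow hn]
  · rw [extendChar_of_ne _ h, extendChar_of_ne _ h, MonoidHom.pow_apply, Units.val_pow_eq_pow_val]

lemma extendChar_mul {X : Scheme.{u}} {x : X} (χ : ResidueChar x) (a b : X.residueField x) :
    extendChar χ (a * b) = extendChar χ a * extendChar χ b := by
  by_cases ha : a = 0
  · rw [(extendChar_eq_zero_iff χ a).2 ha, ha, zero_mul, zero_mul, extendChar_eq_zero_iff]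
  by_cases hb : b = 0
  · rw [(extendChar_eq_zero_iff χ b).2 hb, hb, mul_zero, mul_zero, extendChar_eq_zero_iff]
  rw [extendChar_of_ne _ (mul_ne_zero ha hb), extendChar_of_ne _ ha, extendChar_of_ne _ hb,
    Units.mk0_mul, map_mul, Units.val_mul]

lemma extendChar_pullback {X Y : Scheme.{u}} (f : X ⟶ Y) {x : X} (χ : ResidueChar x)
    (a : Y.residueField (f x)) :
    extendChar (χ.pullback f) a = extendChar χ (f.residueFieldMap x a) := by
  by_cases h : a = 0
  · rw [(extendChar_eq_zero_iff _ _).2 h, h, map_zero, (extendChar_eq_zero_iff _ _).2 rfl]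
  · have h' : f.residueFieldMap x a ≠ 0 := (map_ne_zero (f.residueFieldMap x).hom).2 h
    rw [extendChar_of_ne _ h, extendChar_of_ne _ h']
    unfold ResidueChar.pullback
    rw [MonoidHom.comp_apply]
    congr 2
    exact Units.ext rfl

variable {E : CharCondition X₀ K}

lemma holds_of_injective {x : normalizationIn X₀ K} {χ : ResidueChar x}
    (h : Function.Injective χ) : E.holds χ :=
  E.of_finiteKernel χ (by
    change Finite χ.ker
    rw [(MonoidHom.ker_eq_bot_iff χ).2 h]
    infer_instance)

lemma eval_gal (P : Pt E) (hP : normProj X₀ K P.pt ∈ U) (σ : Gal(K/X₀.functionField))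
    (hσ : normProj X₀ K (P.gal σ).pt ∈ U)
    (r : Γ(normalizationIn X₀ K, normProj X₀ K ⁻¹ᵁ U)) :
    eval U ⟨P.gal σ, hσ⟩ r = eval U ⟨P, hP⟩ (galSections U σ r) := by
  unfold eval
  rw [← residueFieldMap_galMap_evaluation hP]
  exact extendChar_pullback _ _ _

lemma eval_frob (P : Pt E) (hP : normProj X₀ K P.pt ∈ U) (ν : ℕ+)
    (r : Γ(normalizationIn X₀ K, normProj X₀ K ⁻¹ᵁ U)) :
    eval U ⟨P.frob ν, hP⟩ r = eval U ⟨P, hP⟩ r ^ (ν : ℕ) :=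
  extendChar_pow _ ν.ne_zero _

/-- The zero set of the multiplicative map recovers the prime of `x`, and quotients of its values
recover `χ`. Identities between points can thus be checked on sections. -/
lemma eval_injective (hU : IsAffineOpen U) : Function.Injective (eval (E := E) U) := by
  rintro ⟨⟨x, χ, hχ⟩, hx⟩ ⟨⟨y, ψ, hψ⟩, hy⟩ h
  have hV : IsAffineOpen (normProj X₀ K ⁻¹ᵁ U) := hU.preimage _
  have hk : x = y := by
    refine eq_of_ker_evaluation_eq hV hx hy ?_
    ext r
    have hr := congrFun h r
    rw [RingHom.mem_ker, RingHom.mem_ker]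
    exact (extendChar_eq_zero_iff χ _).symm.trans
      ((Eq.congr_left hr).trans (extendChar_eq_zero_iff ψ _))
  subst hk
  congr
  refine MonoidHom.ext fun a => Units.ext ?_
  obtain ⟨r, s, hs, ha⟩ := exists_mul_evaluation_eq hV hx (a : (normalizationIn X₀ K).residueField x)
  have key : ∀ ω : ResidueChar x, (ω a : ℂ) * extendChar ω
      ((normalizationIn X₀ K).evaluation (normProj X₀ K ⁻¹ᵁ U) x hx s) = extendChar ω
      ((normalizationIn X₀ K).evaluation (normProj X₀ K ⁻¹ᵁ U) x hx r) := by
    intro ω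
    rw [← ha, extendChar_mul, extendChar_unit]
  have hr : extendChar χ _ = extendChar ψ _ := congrFun h r
  have hs' : extendChar χ _ = extendChar ψ _ := congrFun h s
  have h1 := key χ
  rw [hr, hs', ← key ψ] at h1
  exact mul_right_cancel₀ ((extendChar_eq_zero_iff ψ _).not.2 hs) h1

end Pt

end Points

/-! ### Relations `F_a P = (F_b P) ^ σ` over closed and non-closed points. -/

section Arithmetic

variable {X₀ : Scheme.{u}} [IsArithmeticScheme X₀]
  {K : Type u} [Field K] [Algebra X₀.functionField K] {U : X₀.Opens}

lemma finite_residueField_base {x₀ : X₀} (h : IsClosed {x₀}) : Finite (X₀.residueField x₀) :=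
  have := IsArithmeticScheme.locallyOfFiniteType (X := X₀)
  finite_residueField_of_isClosed h

lemma isMaximal_ker_evaluation_of_isClosed_normProj (hU : IsAffineOpen U) {x : normalizationIn X₀ K}
    (hx : x ∈ normProj X₀ K ⁻¹ᵁ U) (h : IsClosed {normProj X₀ K x}) :
    (RingHom.ker ((normalizationIn X₀ K).evaluation (normProj X₀ K ⁻¹ᵁ U) x hx).hom).IsMaximal := by
  have : Nonempty U := ⟨⟨_, hx⟩⟩
  have := isIntegralClosure_sections (K := K) U hU
  have : Algebra.IsIntegral Γ(X₀, U) Γ(normalizationIn X₀ K, normProj X₀ K ⁻¹ᵁ U) :=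
    IsIntegralClosure.isIntegral_algebra Γ(X₀, U) K
  have hm := isMaximal_ker_evaluation hU (x := normProj X₀ K x) hx h
  rw [← comap_ker_evaluation hx] at hm
  have := RingHom.ker_isPrime
    ((normalizationIn X₀ K).evaluation (normProj X₀ K ⁻¹ᵁ U) x hx).hom
  exact Ideal.isMaximal_of_isIntegral_of_isMaximal_comap _ hm

lemma isMulTorsion_residueField {x : normalizationIn X₀ K} (h : IsClosed {normProj X₀ K x}) :
    IsMulTorsion ((normalizationIn X₀ K).residueField x)ˣ := by
  obtain ⟨U, hU, hx⟩ := exists_isAffineOpen_mem (normProj X₀ K x)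
  have := finite_residueField_base h
  refine isMulTorsion_units_of_isIntegral ((normProj X₀ K).residueFieldMap x).hom fun a => ?_
  obtain ⟨r, rfl⟩ := evaluation_surjective_of_isMaximal (hU.preimage _) hx
    (isMaximal_ker_evaluation_of_isClosed_normProj hU hx h) a
  have : Nonempty U := ⟨⟨_, hx⟩⟩
  have := isIntegralClosure_sections (K := K) U hU
  obtain ⟨p, hp, hr⟩ := IsIntegralClosure.isIntegral Γ(X₀, U) K r
  refine ⟨p.map (X₀.evaluation U (normProj X₀ K x) hx).hom, hp.map _, ?_⟩
  rw [Polynomial.eval₂_map]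
  have hcomp : ((normProj X₀ K).residueFieldMap x).hom.comp
      (X₀.evaluation U (normProj X₀ K x) hx).hom =
      ((normalizationIn X₀ K).evaluation (normProj X₀ K ⁻¹ᵁ U) x hx).hom.comp
        (algebraMap Γ(X₀, U) _) :=
    RingHom.ext fun a => residueFieldMap_normProj_evaluation hx a
  rw [hcomp]
  have := congrArg ((normalizationIn X₀ K).evaluation (normProj X₀ K ⁻¹ᵁ U) x hx) hr
  rw [map_zero] at this
  rw [← this]
  exact (Polynomial.hom_eval₂ p _ _ r).symm

lemma isRadiciallyClosed_residueField (hK : IsRadiciallyClosed K) {x : normalizationIn X₀ K}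
    (h : IsClosed {normProj X₀ K x}) :
    IsRadiciallyClosed ((normalizationIn X₀ K).residueField x) := by
  obtain ⟨U, hU, hx⟩ := exists_isAffineOpen_mem (normProj X₀ K x)
  have : Nonempty U := ⟨⟨_, hx⟩⟩
  have := isIntegralClosure_sections (K := K) U hU
  exact hK.of_surjective (A := Γ(X₀, U)) _ (evaluation_surjective_of_isMaximal (hU.preimage _) hx
    (isMaximal_ker_evaluation_of_isClosed_normProj hU hx h))

/-- The projection is a closed map, and its image contains the generic point. -/
lemma normProj_surjective : Function.Surjective (normProj X₀ K) := by
  have hc : IsClosed (Set.range (normProj X₀ K)) := (normProj X₀ K).isClosedMap.isClosed_range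
  have hg : genericPoint X₀ ∈ Set.range (normProj X₀ K) := by
    let z : Spec (.of K) := IsLocalRing.closedPoint K
    refine ⟨(genericMap X₀ K).toNormalization z, ?_⟩
    rw [← Scheme.Hom.comp_apply, Scheme.Hom.toNormalization_fromNormalization, genericMap_apply]
  intro y
  have hy : y ∈ closure {genericPoint X₀} := by
    rw [(genericPoint_spec X₀).def]
    trivial
  exact hc.closure_subset_iff.2 (Set.singleton_subset_iff.2 hg) hy

namespace Pt

variable {E : CharCondition X₀ K}

lemma extendChar_map_pow {X : Scheme.{u}} {x : X} (χ : ResidueChar x) (a : X.residueField x)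
    (n : ℕ) : extendChar χ (a ^ n) = extendChar χ a ^ n := by
  induction n with
  | zero => simpa using extendChar_unit χ 1
  | succ n ih => rw [pow_succ, extendChar_mul, ih, pow_succ]

/-- A point over a closed point has a character that is a power of an injective one. -/
lemma exists_injective_frob_eq (hK : IsRadiciallyClosed K) (P : Pt E)
    (h : IsClosed {normProj X₀ K P.pt}) :
    ∃ (χ : ResidueChar P.pt) (hχ : E.holds χ) (m : ℕ+), Function.Injective χ ∧
      P.char = χ ^ (m : ℕ) ∧ P = frob m ⟨P.pt, χ, hχ⟩ := by
  have hT := isMulTorsion_residueField h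
  have hker : Finite P.char.ker := by
    have h1 := (E.maxCondition _ P.holds).1
    -- Every unit is torsion here, so finiteness of the torsion of the kernel is finiteness of the
    -- kernel.
    have h2 : CommGroup.torsion P.char.ker = ⊤ := top_le_iff.1 fun y _ => hT.subgroup _ y
    rw [h2] at h1
    exact Finite.of_equiv _ Subgroup.topEquiv.toEquiv
  obtain ⟨χ, m, hm, hinj, hχ⟩ :=
    (isRadiciallyClosed_residueField hK h).exists_injective_pow_eq P.char hker
  refine ⟨χ, holds_of_injective hinj, ⟨m, hm⟩, hinj, hχ, ?_⟩
  cases P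
  unfold frob
  congr

lemma eval_pow_eq_of_frob_eq_gal {P : Pt E} {a b : ℕ+} {σ : Gal(K/X₀.functionField)}
    (hab : P.frob a = (P.frob b).gal σ) (hP : normProj X₀ K P.pt ∈ U)
    (r : Γ(normalizationIn X₀ K, normProj X₀ K ⁻¹ᵁ U)) :
    eval U ⟨P, hP⟩ r ^ (a : ℕ) = eval U ⟨P, hP⟩ (galSections U σ r) ^ (b : ℕ) := by
  have hP' : normProj X₀ K ((P.frob b).gal σ).pt ∈ U := by
    rw [← hab]
    exact hP
  have h1 : eval U ⟨P.frob a, hP⟩ r = eval U ⟨(P.frob b).gal σ, hP'⟩ r := by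
    congr 2
  rwa [eval_frob, eval_gal (P.frob b) hP σ hP', eval_frob] at h1

/-- The relation shows that `σ` preserves the prime of `x`, hence induces an endomorphism of `κ(x)`
over `κ(x₀)`. Replacing `χ` by an injective root turns the relation into `y ^ a = σ(y) ^ b`. -/
lemma exists_zpow_of_frob_eq_gal (hK : IsRadiciallyClosed K) (P : Pt E)
    (h : IsClosed {normProj X₀ K P.pt}) {a b : ℕ+} {σ : Gal(K/X₀.functionField)}
    (hab : P.frob a = (P.frob b).gal σ) :
    ∃ n : ℤ, (a : ℝ) / b = (pointNorm (normProj X₀ K P.pt) : ℝ) ^ n := by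
  obtain ⟨U, hU, hx⟩ := exists_isAffineOpen_mem (normProj X₀ K P.pt)
  have : Nonempty U := ⟨⟨_, hx⟩⟩
  have := isIntegralClosure_sections (K := K) U hU
  have := finite_residueField_base h
  have hF := isRadiciallyClosed_residueField hK h
  let ev := ((normalizationIn X₀ K).evaluation (normProj X₀ K ⁻¹ᵁ U) P.pt hx).hom
  have hev : Function.Surjective ev := evaluation_surjective_of_isMaximal (hU.preimage _) hx
    (isMaximal_ker_evaluation_of_isClosed_normProj hU hx h)
  let act := (galSections (K := K) U σ).hom
  have hφ : ∀ r, extendChar P.char (ev r) ^ (a : ℕ) = extendChar P.char (ev (act r)) ^ (b : ℕ) :=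
    eval_pow_eq_of_frob_eq_gal hab hx
  have hle : RingHom.ker ev ≤ RingHom.ker (ev.comp act) := by
    intro r hr
    have h1 := hφ r
    rw [RingHom.mem_ker.1 hr, (extendChar_eq_zero_iff _ _).2 rfl, zero_pow a.ne_zero] at h1
    exact (extendChar_eq_zero_iff _ _).1 (pow_eq_zero_iff b.ne_zero |>.1 h1.symm)
  let σ' := ev.liftOfSurjective hev ⟨ev.comp act, hle⟩
  have hσ' : ∀ r, σ' (ev r) = ev (act r) := fun r =>
    RingHom.liftOfRightInverse_comp_apply ev _ (Function.rightInverse_surjInv hev)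
      ⟨ev.comp act, hle⟩ r
  obtain ⟨χ, -, m, hinj, hχ, -⟩ := exists_injective_frob_eq hK P h
  refine hF.exists_zpow_of_pow_eq (isMulTorsion_residueField h)
    ((normProj X₀ K).residueFieldMap P.pt).hom σ' (fun c => ?_) a.pos b.pos (fun y => ?_)
  · obtain ⟨c, rfl⟩ := evaluation_surjective_of_isMaximal hU hx (isMaximal_ker_evaluation hU hx h) c
    have h1 : ((normProj X₀ K).residueFieldMap P.pt).hom
        (X₀.evaluation U (normProj X₀ K P.pt) hx c) = ev (algebraMap Γ(X₀, U) _ c) :=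
      residueFieldMap_normProj_evaluation hx c
    refine (congrArg σ' h1).trans ((hσ' _).trans (Eq.trans ?_ h1.symm))
    exact congrArg ev (act_algebraMap Γ(X₀, U) (fun σ => (galSections (K := K) U σ).hom)
      (sectionsToField_galSections U) σ c)
  -- With `P.char = χ ^ m` and `y = w ^ m`, injectivity of `χ` gives `w ^ (m a) = σ(w) ^ (m b)`,
  -- which is the claim for `y`.
  · obtain ⟨w, rfl⟩ := hF.pow_surjective m.pos y
    obtain ⟨r, hr⟩ := hev w
    let w' := Units.map (σ' : _ →* (normalizationIn X₀ K).residueField P.pt) w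
    have hw' : (w' : (normalizationIn X₀ K).residueField P.pt) = ev (act r) := by
      rw [← hσ', hr]
      rfl
    have h1 := hφ r
    rw [hr, ← hw', extendChar_unit, extendChar_unit, ← Units.val_pow_eq_pow_val,
      ← Units.val_pow_eq_pow_val, Units.val_inj, hχ, MonoidHom.pow_apply, MonoidHom.pow_apply,
      ← pow_mul, ← pow_mul, ← map_pow, ← map_pow] at h1
    have h2 := congrArg Units.val (hinj h1)
    rw [pow_mul, pow_mul] at h2
    simpa [w'] using h2

end Pt

variable [IsGalois X₀.functionField K]

/-- In a chart this is transitivity of the Galois group on the primes over a given prime. -/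
lemma exists_galMap_eq {x y : normalizationIn X₀ K} (h : normProj X₀ K x = normProj X₀ K y) :
    ∃ σ, galMap X₀ σ x = y := by
  obtain ⟨U, hU, hx⟩ := exists_isAffineOpen_mem (normProj X₀ K x)
  have hy : y ∈ normProj X₀ K ⁻¹ᵁ U := by
    change normProj X₀ K y ∈ U
    rwa [← h]
  have : Nonempty U := ⟨⟨_, hx⟩⟩
  have := isIntegralClosure_sections (K := K) U hU
  have := functionField_isFractionRing_of_isAffineOpen X₀ U hU
  have := isIntegrallyClosed_sections (IsArithmeticScheme.normal (X := X₀)) hU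
  have hP := RingHom.ker_isPrime
    ((normalizationIn X₀ K).evaluation (normProj X₀ K ⁻¹ᵁ U) x hx).hom
  have hQ := RingHom.ker_isPrime
    ((normalizationIn X₀ K).evaluation (normProj X₀ K ⁻¹ᵁ U) y hy).hom
  have hker : ∀ z (h : normProj X₀ K x = z) (hz : z ∈ U),
      RingHom.ker (X₀.evaluation U (normProj X₀ K x) hx).hom =
        RingHom.ker (X₀.evaluation U z hz).hom := by
    rintro _ rfl _
    rfl
  obtain ⟨σ, hσ⟩ := exists_comap_act_eq Γ(X₀, U) (fun σ => (galSections (K := K) U σ).hom)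
    (sectionsToField_galSections U)
    (RingHom.ker ((normalizationIn X₀ K).evaluation (normProj X₀ K ⁻¹ᵁ U) x hx).hom)
    (RingHom.ker ((normalizationIn X₀ K).evaluation (normProj X₀ K ⁻¹ᵁ U) y hy).hom) (by
      rw [comap_ker_evaluation hx, comap_ker_evaluation hy]
      exact hker _ h hy)
  refine ⟨σ, (eq_of_ker_evaluation_eq (hU.preimage _) hy (galMap_mem hx σ) ?_).symm⟩
  rw [hσ]
  ext r
  rw [Ideal.mem_comap, RingHom.mem_ker, RingHom.mem_ker]
  refine Iff.trans (Eq.congr_left (residueFieldMap_galMap_evaluation hx σ r).symm) ?_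
  exact map_eq_zero ((galMap X₀ σ).residueFieldMap x).hom

namespace Pt

variable {E : CharCondition X₀ K}

/-- A Frobenius `σ` at `x` satisfies `σ r ≡ r ^ N` modulo the prime of `x`, so `χ(σ r) = χ(r) ^ N`.
-/
lemma exists_frob_pointNorm_eq_gal (P : Pt E) (h : IsClosed {normProj X₀ K P.pt}) (ν : ℕ+)
    (hν : (ν : ℕ) = pointNorm (normProj X₀ K P.pt)) : ∃ σ, P.frob ν = P.gal σ := by
  obtain ⟨U, hU, hx⟩ := exists_isAffineOpen_mem (normProj X₀ K P.pt)
  have : Nonempty U := ⟨⟨_, hx⟩⟩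
  have := isIntegralClosure_sections (K := K) U hU
  have := functionField_isFractionRing_of_isAffineOpen X₀ U hU
  have := isIntegrallyClosed_sections (IsArithmeticScheme.normal (X := X₀)) hU
  have := finite_residueField_base h
  set Q := RingHom.ker ((normalizationIn X₀ K).evaluation (normProj X₀ K ⁻¹ᵁ U) P.pt hx).hom with hQ
  have hm : Q.IsMaximal := isMaximal_ker_evaluation_of_isClosed_normProj hU hx h
  let e : (Γ(X₀, U) ⧸ Q.comap (algebraMap Γ(X₀, U) _)) ≃+* X₀.residueField (normProj X₀ K P.pt) :=
    (Ideal.quotEquivOfEq (comap_ker_evaluation hx)).trans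
      (RingHom.quotientKerEquivOfSurjective (evaluation_surjective_of_isMaximal hU hx
        (isMaximal_ker_evaluation hU hx h)))
  have hfin : Finite (Γ(X₀, U) ⧸ Q.comap (algebraMap Γ(X₀, U) _)) := Finite.of_equiv _ e.symm.toEquiv
  have hcard : Nat.card (Γ(X₀, U) ⧸ Q.comap (algebraMap Γ(X₀, U) _)) = ν := by
    rw [hν]
    exact Nat.card_congr e.toEquiv
  obtain ⟨σ, hσ⟩ := exists_act_sub_pow_mem Γ(X₀, U) (fun σ => (galSections (K := K) U σ).hom)
    (sectionsToField_galSections U) Q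
  refine ⟨σ, ?_⟩
  have hx' : normProj X₀ K (P.gal σ).pt ∈ U := galMap_mem hx σ
  have := eval_injective (E := E) hU (a₁ := ⟨P.frob ν, hx⟩) (a₂ := ⟨P.gal σ, hx'⟩) (by
    funext r
    rw [eval_frob, eval_gal P hx σ hx']
    unfold eval
    rw [← extendChar_map_pow]
    congr 1
    have h1 := hσ r
    rw [hcard, RingHom.mem_ker, map_sub, sub_eq_zero, map_pow] at h1
    exact h1.symm)
  exact congrArg Subtype.val this

/-- Iterating the relation along a finite `σ`-orbit of a section `t` compares two powers of the
single number `χ(t)`, which is chosen not to be a root of unity. -/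
lemma eq_of_frob_eq_gal (P : Pt E) (h : ¬ IsClosed {normProj X₀ K P.pt}) {a b : ℕ+}
    {σ : Gal(K/X₀.functionField)} (hab : P.frob a = (P.frob b).gal σ) : a = b := by
  obtain ⟨U, hU, hx⟩ := exists_isAffineOpen_mem (normProj X₀ K P.pt)
  have : Nonempty U := ⟨⟨_, hx⟩⟩
  have := isIntegralClosure_sections (K := K) U hU
  let ev := (normalizationIn X₀ K).evaluation (normProj X₀ K ⁻¹ᵁ U) P.pt hx
  have hT : ¬ IsMulTorsion ((normalizationIn X₀ K).residueField P.pt)ˣ := by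
    refine fun hT => h (isClosed_singleton_of_isMulTorsion fun y => ?_)
    have := hT (Units.map (((normProj X₀ K).residueFieldMap P.pt).hom : _ →* _) y)
    exact (Function.Injective.isOfFinOrder_iff (Units.map_injective
      ((normProj X₀ K).residueFieldMap P.pt).hom.injective)).1 this
  have hy : ∃ y, ¬ IsOfFinOrder (P.char y) := by
    by_contra! hy
    exact hT ((E.maxCondition _ P.holds).2 hy)
  obtain ⟨y, hy⟩ := hy
  obtain ⟨r, s, hs, hrs⟩ := exists_mul_evaluation_eq (hU.preimage (normProj X₀ K)) hx
    (y : (normalizationIn X₀ K).residueField P.pt)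
  have hr : ev r ≠ 0 := by
    rw [← hrs]
    exact mul_ne_zero y.ne_zero hs
  have hmul : y * Units.mk0 _ hs = Units.mk0 _ hr := Units.ext hrs
  -- `y` is a quotient of values of sections; if both had images of finite order, so would `y`.
  obtain ⟨t, ht, hu⟩ : ∃ t, ∃ ht : ev t ≠ 0, ¬ IsOfFinOrder (P.char (Units.mk0 _ ht)) := by
    by_contra! hall
    refine hy ?_
    rw [eq_mul_inv_of_mul_eq hmul, map_mul, map_inv]
    exact (hall r hr).mul (hall s hs).inv
  let act := galSections (K := K) U σ
  have hφ : ∀ r, eval U ⟨P, hx⟩ r ^ (a : ℕ) = eval U ⟨P, hx⟩ (act r) ^ (b : ℕ) :=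
    eval_pow_eq_of_frob_eq_gal hab hx
  have hit : ∀ (k : ℕ) r, eval U ⟨P, hx⟩ r ^ ((a : ℕ) ^ k) =
      eval U ⟨P, hx⟩ (act^[k] r) ^ ((b : ℕ) ^ k) := by
    intro k
    induction k with
    | zero => intro r; simp
    | succ k ih =>
      intro r
      rw [Function.iterate_succ_apply', pow_succ, pow_mul, ih, ← pow_mul, mul_comm, pow_mul, hφ,
        ← pow_mul, mul_comm, pow_succ]
  obtain ⟨m, hm, hmt⟩ := exists_iterate_eq_self (K := X₀.functionField) (L := K) Γ(X₀, U)
    (fun σ => (galSections (K := K) U σ).hom) (sectionsToField_galSections U) σ t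
  have h1 := hit m t
  rw [show act^[m] t = t from hmt] at h1
  have he : eval U ⟨P, hx⟩ t = P.char (Units.mk0 _ ht) := extendChar_of_ne _ ht
  rw [he, ← Units.val_pow_eq_pow_val, ← Units.val_pow_eq_pow_val, Units.val_inj] at h1
  have h2 := injective_pow_iff_not_isOfFinOrder.2 hu h1
  exact PNat.coe_injective (Nat.pow_left_injective hm.ne' h2)

end Pt

end Arithmetic

/-! ### Isotropy in the colimit and the suspension. -/

section Quotients

namespace Pt₀

variable {X₀ : Scheme.{u}} [AlgebraicGeometry.IsIntegral X₀]
  {K : Type u} [Field K] [Algebra X₀.functionField K] {E : CharCondition X₀ K}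

lemma mk_eq_mk_iff {P Q : Pt E} : mk P = mk Q ↔ ∃ σ, P = Q.gal σ := by
  refine Quotient.eq.trans ⟨?_, ?_⟩
  · rintro ⟨σ, rfl⟩
    exact ⟨σ.unop, rfl⟩
  · rintro ⟨σ, rfl⟩
    exact ⟨MulOpposite.op σ, rfl⟩

lemma smul_mk (ν : ℕ+) (P : Pt E) : ν • mk P = mk (P.frob ν) := rfl

lemma continuous_mk : Continuous (mk (E := E)) := continuous_coinduced_rng

end Pt₀

namespace Colim

variable {Y : Type u} [MulAction ℕ+ Y]

lemma smul_mk (q : {q : ℚ // 0 < q}) (ν : ℕ+) (y : Y) :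
    q • mk ν y = mk (den q * ν) (num q • y) := rfl

lemma mk_eq_mk_iff {ν ν' : ℕ+} {y y' : Y} :
    mk ν y = mk ν' y' ↔ ∃ μ : ℕ+, (μ * ν') • y = (μ * ν) • y' := Quotient.eq

/-- The positive rational number `a / b`. -/
def ratDiv (a b : ℕ+) : {q : ℚ // 0 < q} :=
  ⟨(a : ℚ) / b, div_pos (by exact_mod_cast a.pos) (by exact_mod_cast b.pos)⟩

lemma num_mul_eq (a b : ℕ+) : num (ratDiv a b) * b = a * den (ratDiv a b) := by
  have h := num_div_den (ratDiv a b)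
  have h1 : ((den (ratDiv a b) : ℕ) : ℚ) ≠ 0 := by exact_mod_cast (den (ratDiv a b)).ne_zero
  have h2 : ((b : ℕ) : ℚ) ≠ 0 := by exact_mod_cast b.ne_zero
  have h3 : ((num (ratDiv a b) : ℕ) : ℚ) / (den (ratDiv a b) : ℕ) = (a : ℚ) / b := h
  rw [div_eq_div_iff h1 h2] at h3
  apply PNat.coe_injective
  push_cast
  exact_mod_cast h3

/-- The action is defined through lowest terms; this formula allows any fraction. -/
lemma ratDiv_smul_mk (a b ν : ℕ+) (y : Y) : ratDiv a b • mk ν y = mk (b * ν) (a • y) := by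
  rw [smul_mk, mk_eq_mk_iff]
  refine ⟨1, ?_⟩
  rw [smul_smul, smul_smul]
  congr 1
  calc 1 * (b * ν) * num (ratDiv a b) = num (ratDiv a b) * b * ν := by rw [one_mul]; ac_rfl
    _ = _ := by rw [num_mul_eq, one_mul]; ac_rfl

lemma continuous_mk [TopologicalSpace Y] (ν : ℕ+) : Continuous (mk (Y := Y) ν) :=
  continuous_iSup_rng (i := ν) continuous_coinduced_rng

end Colim

namespace Susp

variable {Z : Type u} [MulAction {q : ℚ // 0 < q} Z]

lemma mk_eq_mk_iff {P Q : Z} {u v : {r : ℝ // 0 < r}} : mk P u = mk Q v ↔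
    ∃ q : {q : ℚ // 0 < q}, Q = q⁻¹ • P ∧ (v : ℝ) = (q : ℚ) * (u : ℝ) := Quotient.eq

lemma smul_mk (v : {r : ℝ // 0 < r}) (P : Z) (u : {r : ℝ // 0 < r}) :
    v • mk P u = mk P (u * v) := rfl

lemma exists_eq_mk (z : Susp Z) : ∃ P u, z = mk P u := by
  induction z using Quotient.inductionOn with
  | h a => exact ⟨a.1, a.2, rfl⟩

lemma continuous_mk [TopologicalSpace Z] :
    Continuous (fun a : Z × {r : ℝ // 0 < r} => mk a.1 a.2) := continuous_coinduced_rng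

lemma mk_rat_smul (q : {q : ℚ // 0 < q}) (P : Z) (u : {r : ℝ // 0 < r}) :
    mk (q • P) u = mk P (⟨(q : ℚ), by exact_mod_cast q.2⟩ * u) :=
  mk_eq_mk_iff.2 ⟨q, (inv_smul_smul q P).symm, rfl⟩

/-- A positive real number fixes the class of `(F_ν⁻¹ y, u)` if and only if it is a quotient `a / b`
with `F_a y = F_b y`. -/
lemma mem_stabilizer_mk_iff {Y : Type u} [MulAction ℕ+ Y] (ν : ℕ+) (y : Y)
    (u v : {r : ℝ // 0 < r}) :
    v ∈ MulAction.stabilizer {r : ℝ // 0 < r} (mk (Colim.mk ν y) u) ↔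
      ∃ a b : ℕ+, (v : ℝ) = (a : ℝ) / b ∧ a • y = b • y := by
  rw [MulAction.mem_stabilizer_iff, smul_mk]
  constructor
  · intro h
    obtain ⟨q, hq, hu⟩ := mk_eq_mk_iff.1 h.symm
    have hv : (v : ℝ) = (q : ℚ) := by
      have h0 : (u : ℝ) ≠ 0 := u.2.ne'
      rw [Positive.val_mul, mul_comm] at hu
      exact mul_right_cancel₀ h0 hu
    rw [eq_inv_smul_iff, Colim.smul_mk, Colim.mk_eq_mk_iff] at hq
    obtain ⟨μ, hμ⟩ := hq
    -- Equality in the colimit holds in `Y` only after a further `F_μ`; the common factor `μ * ν`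
    -- cancels in the quotient.
    refine ⟨μ * ν * Colim.num q, μ * ν * Colim.den q, ?_, ?_⟩
    · rw [hv, ← Colim.num_div_den q]
      push_cast
      rw [mul_div_mul_left]
      have h1 : (μ : ℝ) ≠ 0 := by exact_mod_cast μ.ne_zero
      have h2 : (ν : ℝ) ≠ 0 := by exact_mod_cast ν.ne_zero
      exact mul_ne_zero h1 h2
    · rw [mul_smul, hμ]
      congr 1
      ac_rfl
  · rintro ⟨a, b, hv, hab⟩
    have hfix : Colim.ratDiv a b • Colim.mk ν y = Colim.mk ν y := by
      rw [Colim.ratDiv_smul_mk, Colim.mk_eq_mk_iff]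
      refine ⟨1, ?_⟩
      rw [one_mul, one_mul, mul_smul, hab, smul_smul, smul_smul, mul_comm]
    -- If `q = a / b` fixes `P`, then `[P, u] = [q P, u] = [P, q u]`.
    conv_rhs => rw [← hfix, mk_rat_smul]
    congr 1
    apply Subtype.ext
    rw [Positive.val_mul, Positive.val_mul, hv, mul_comm]
    congr 1
    simp [Colim.ratDiv]

lemma flow_eq_self_iff (t : ℝ) (z : Susp Z) : flow t z = z ↔
    (⟨Real.exp t, Real.exp_pos t⟩ : {r : ℝ // 0 < r}) ∈
      MulAction.stabilizer {r : ℝ // 0 < r} z := Iff.rfl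

end Susp

end Quotients

/-! ### Packets as fibres over points of `X₀`. -/

section Packets

variable {X₀ : Scheme.{u}} [AlgebraicGeometry.IsIntegral X₀]
  {K : Type u} [Field K] [Algebra X₀.functionField K] {E : CharCondition X₀ K}

lemma colimProj_smul (q : {q : ℚ // 0 < q}) (P : Colim (Pt₀ E)) :
    colimProj (q • P) = colimProj P := by
  induction P using Quotient.inductionOn with
  | h a => exact Pt₀.proj_smul _ _

lemma mk_mem_packet_iff {P : Colim (Pt₀ E)} {u : {r : ℝ // 0 < r}} {x₀ : X₀} :
    Susp.mk P u ∈ packet E x₀ ↔ colimProj P = x₀ := by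
  constructor
  · rintro ⟨Q, v, hQ, h⟩
    obtain ⟨q, rfl, -⟩ := Susp.mk_eq_mk_iff.1 h
    rwa [colimProj_smul] at hQ
  · exact fun h => ⟨P, u, h, rfl⟩

lemma exists_mem_packet (z : PhaseSpace E) : ∃ x₀, z ∈ packet E x₀ := by
  obtain ⟨P, u, rfl⟩ := Susp.exists_eq_mk z
  exact ⟨_, mk_mem_packet_iff.2 rfl⟩

lemma eq_of_mem_packet {z : PhaseSpace E} {x₀ y₀ : X₀} (hx : z ∈ packet E x₀)
    (hy : z ∈ packet E y₀) : x₀ = y₀ := by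
  obtain ⟨P, u, h, rfl⟩ := hx
  rw [← h, mk_mem_packet_iff.1 hy]

lemma smul_mem_packet {z : PhaseSpace E} {x₀ : X₀} (h : z ∈ packet E x₀) (v : {r : ℝ // 0 < r}) :
    v • z ∈ packet E x₀ := by
  obtain ⟨P, u, h, rfl⟩ := h
  exact ⟨P, u * v, h, rfl⟩

/-- Points of a packet in coordinates. -/
lemma exists_eq_of_mem_packet {z : PhaseSpace E} {x₀ : X₀} (h : z ∈ packet E x₀) :
    ∃ (ν : ℕ+) (P : Pt E) (u : {r : ℝ // 0 < r}), normProj X₀ K P.pt = x₀ ∧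
      z = Susp.mk (Colim.mk ν (Pt₀.mk P)) u := by
  obtain ⟨P, u, h, rfl⟩ := h
  induction P using Quotient.inductionOn with
  | h a =>
    obtain ⟨ν, y⟩ := a
    induction y using Quotient.inductionOn with
    | h P => exact ⟨ν, P, u, h, rfl⟩

end Packets

/-! ### Isotropy groups over closed and non-closed points. -/

section Isotropy

variable {X₀ : Scheme.{u}} [IsArithmeticScheme X₀]
  {K : Type u} [Field K] [Algebra X₀.functionField K] [IsGalois X₀.functionField K]
  {E : CharCondition X₀ K}

lemma one_lt_pointNorm {x₀ : X₀} (h : IsClosed {x₀}) : 1 < pointNorm x₀ :=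
  have := finite_residueField_base h
  Finite.one_lt_card

lemma Pt₀.pointNorm_smul (P : Pt E) (h : IsClosed {normProj X₀ K P.pt}) (ν : ℕ+)
    (hν : (ν : ℕ) = pointNorm (normProj X₀ K P.pt)) : ν • Pt₀.mk P = Pt₀.mk P := by
  obtain ⟨σ, hσ⟩ := P.exists_frob_pointNorm_eq_gal h ν hν
  exact Pt₀.mk_eq_mk_iff.2 ⟨σ, hσ⟩

/-- The isotropy groups in the packets of the closed points. -/
lemma stabilizer_eq_of_mem_packet (hK : IsRadiciallyClosed K) {x₀ : X₀} (h : IsClosed {x₀})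
    {z : PhaseSpace E} (hz : z ∈ packet E x₀) (v : {r : ℝ // 0 < r}) :
    v ∈ MulAction.stabilizer {r : ℝ // 0 < r} z ↔ ∃ n : ℤ, (v : ℝ) = (pointNorm x₀ : ℝ) ^ n := by
  obtain ⟨ν, P, u, rfl, rfl⟩ := exists_eq_of_mem_packet hz
  constructor
  · intro hv
    obtain ⟨a, b, hv, hab⟩ := (Susp.mem_stabilizer_mk_iff _ _ _ _).1 hv
    obtain ⟨σ, hσ⟩ := Pt₀.mk_eq_mk_iff.1 hab
    rw [hv]
    exact P.exists_zpow_of_frob_eq_gal hK h hσ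
  · rintro ⟨n, hn⟩
    have h0 : 0 < pointNorm (normProj X₀ K P.pt) := zero_lt_one.trans (one_lt_pointNorm h)
    let N : {r : ℝ // 0 < r} := ⟨pointNorm (normProj X₀ K P.pt), by exact_mod_cast h0⟩
    have hN : N ∈ MulAction.stabilizer {r : ℝ // 0 < r} (Susp.mk (Colim.mk ν (Pt₀.mk P)) u) := by
      rw [Susp.mem_stabilizer_mk_iff]
      refine ⟨⟨pointNorm (normProj X₀ K P.pt), h0⟩, 1, ?_, ?_⟩
      · simp [N]
      · exact (Pt₀.pointNorm_smul P h ⟨_, h0⟩ rfl).trans (one_smul _ _).symm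
    have hvN : v = N ^ n := by
      apply Subtype.ext
      rw [hn, Positive.coe_zpow]
    rw [hvN]
    exact zpow_mem hN n

lemma stabilizer_eq_bot_of_mem_packet {x₀ : X₀} (h : ¬ IsClosed {x₀})
    {z : PhaseSpace E} (hz : z ∈ packet E x₀) : MulAction.stabilizer {r : ℝ // 0 < r} z = ⊥ := by
  obtain ⟨ν, P, u, rfl, rfl⟩ := exists_eq_of_mem_packet hz
  refine (Subgroup.eq_bot_iff_forall _).2 fun v hv => ?_
  obtain ⟨a, b, hv, hab⟩ := (Susp.mem_stabilizer_mk_iff _ _ _ _).1 hv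
  obtain ⟨σ, hσ⟩ := Pt₀.mk_eq_mk_iff.1 hab
  rw [P.eq_of_frob_eq_gal h hσ, div_self (by exact_mod_cast b.ne_zero)] at hv
  exact Subtype.ext hv

end Isotropy

/-! ### Compactness and nonemptiness of packets. -/

section Compactness

variable {X₀ : Scheme.{u}} [IsArithmeticScheme X₀]
  {K : Type u} [Field K] [Algebra X₀.functionField K] {E : CharCondition X₀ K}

/-- The set is a continuous image of the compact set of injective characters of `κ(x)ˣ`. One chart
is enough for continuity, since the inclusion of each chart is continuous; there a section gives
either 0 or a coordinate. -/
lemma isCompact_setOf_injective_char {x : normalizationIn X₀ K} (h : IsClosed {normProj X₀ K x}) :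
    IsCompact {P : Pt E | P.pt = x ∧ Function.Injective P.char} := by
  obtain ⟨U, hU, hx⟩ := exists_isAffineOpen_mem (normProj X₀ K x)
  have hS := isCompact_injective_monoidHom (isMulTorsion_residueField h)
  set S := {g : ((normalizationIn X₀ K).residueField x)ˣ → ℂ |
    ∃ χ : ResidueChar x, Function.Injective χ ∧ g = fun a => (χ a : ℂ)} with hSdef
  have := isCompact_iff_compactSpace.1 hS
  choose χ hχ hg using fun g : S => g.2
  let F : S → {P : Pt E // normProj X₀ K P.pt ∈ U} :=
    fun g => ⟨⟨x, χ g, Pt.holds_of_injective (hχ g)⟩, hx⟩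
  have hF : @Continuous S _ _ (TopologicalSpace.induced (Pt.eval U) Pi.topologicalSpace) F := by
    refine continuous_induced_rng.2 (continuous_pi fun r => ?_)
    change Continuous fun g : S => Pt.extendChar (χ g)
      ((normalizationIn X₀ K).evaluation (normProj X₀ K ⁻¹ᵁ U) x hx r)
    by_cases h0 : (normalizationIn X₀ K).evaluation (normProj X₀ K ⁻¹ᵁ U) x hx r = 0
    · have : (fun g : S => Pt.extendChar (χ g)
          ((normalizationIn X₀ K).evaluation (normProj X₀ K ⁻¹ᵁ U) x hx r)) = fun _ => 0 :=
        funext fun g => (Pt.extendChar_eq_zero_iff _ _).2 h0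
      rw [this]
      exact continuous_const
    · have : (fun g : S => Pt.extendChar (χ g)
          ((normalizationIn X₀ K).evaluation (normProj X₀ K ⁻¹ᵁ U) x hx r)) =
          fun g => g.1 (Units.mk0 _ h0) :=
        funext fun g => (Pt.extendChar_of_ne _ h0).trans (congrFun (hg g) _).symm
      rw [this]
      exact (continuous_apply _).comp continuous_subtype_val
  have hF' : Continuous (fun g => (F g).1) :=
    continuous_iSup_rng (i := (⟨U, hU⟩ : X₀.affineOpens))
      (@Continuous.comp _ _ _ _ (_) (_) _ _ continuous_coinduced_rng hF)
  convert isCompact_range hF' using 1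
  ext P
  constructor
  · obtain ⟨y, ψ, hψ⟩ := P
    rintro ⟨hy, hinj⟩
    dsimp only at hy hinj
    subst hy
    let g : S := ⟨fun a => (ψ a : ℂ), ψ, hinj, rfl⟩
    refine ⟨g, ?_⟩
    have : χ g = ψ := MonoidHom.ext fun a => Units.ext (congrFun (hg g) a).symm
    simp only [F, this]
  · rintro ⟨g, rfl⟩
    exact ⟨rfl, hχ g⟩

lemma nonempty_packet {x₀ : X₀} (h : IsClosed {x₀}) : (packet E x₀).Nonempty := by
  obtain ⟨x, rfl⟩ := normProj_surjective (K := K) x₀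
  obtain ⟨χ, hχ⟩ := exists_injective_monoidHom_complexUnits (isMulTorsion_residueField h)
  exact ⟨Susp.mk (Colim.mk 1 (Pt₀.mk ⟨x, χ, Pt.holds_of_injective hχ⟩)) 1, mk_mem_packet_iff.2 rfl⟩

variable [IsGalois X₀.functionField K]

/-- The Galois group moves every point to the chosen `x`. The character is a power of an injective
one, and the exponent, like the index `ν`, is absorbed into `u` by the rational action. The isotropy
group then brings `u` into `[1, N x₀]`. -/
lemma isCompact_packet (hK : IsRadiciallyClosed K) {x₀ : X₀} (h : IsClosed {x₀}) :
    IsCompact (packet E x₀) := by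
  obtain ⟨x, rfl⟩ := normProj_surjective (K := K) x₀
  have hA := isCompact_setOf_injective_char (E := E) h
  have hI : IsCompact {u : {r : ℝ // 0 < r} | (u : ℝ) ∈
      Set.Icc 1 (pointNorm (normProj X₀ K x) : ℝ)} := by
    rw [Subtype.isCompact_iff]
    convert isCompact_Icc (a := (1 : ℝ)) (b := (pointNorm (normProj X₀ K x) : ℝ)) using 1
    ext r
    constructor
    · rintro ⟨u, hu, rfl⟩
      exact hu
    · exact fun hr => ⟨⟨r, zero_lt_one.trans_le hr.1⟩, hr, rfl⟩
  have hc : Continuous fun a : Pt E × {r : ℝ // 0 < r} =>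
      Susp.mk (Colim.mk 1 (Pt₀.mk a.1)) a.2 :=
    Susp.continuous_mk.comp
      ((((Colim.continuous_mk 1).comp Pt₀.continuous_mk).comp continuous_fst).prodMk continuous_snd)
  convert (hA.prod hI).image hc using 1
  ext z
  constructor
  · intro hz
    obtain ⟨ν, P, u, hP, rfl⟩ := exists_eq_of_mem_packet hz
    obtain ⟨τ, hτ⟩ := exists_galMap_eq hP
    have hP' : normProj X₀ K (P.gal τ).pt = normProj X₀ K x := congrArg (normProj X₀ K) hτ
    obtain ⟨χ, hχ, m, hinj, -, hm⟩ := Pt.exists_injective_frob_eq hK (P.gal τ) (by rwa [hP'])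
    set Q : Pt E := ⟨(P.gal τ).pt, χ, hχ⟩ with hQ
    have h1 : Pt₀.mk P = m • Pt₀.mk Q := by
      rw [Pt₀.smul_mk, ← hm]
      exact (Pt₀.mk_eq_mk_iff.2 ⟨τ, rfl⟩).symm
    have h2 : Colim.mk ν (Pt₀.mk P) = Colim.ratDiv m ν • Colim.mk 1 (Pt₀.mk Q) := by
      rw [h1, Colim.ratDiv_smul_mk, mul_one]
    rw [h2, Susp.mk_rat_smul] at hz ⊢
    generalize (⟨((Colim.ratDiv m ν).1 : ℝ), _⟩ : {r : ℝ // 0 < r}) * u = w at hz ⊢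
    have hN : (1 : ℝ) < pointNorm (normProj X₀ K x) := by exact_mod_cast one_lt_pointNorm h
    -- With `N ^ n ≤ w < N ^ (n + 1)`, multiplication by `N ^ (-n)` fixes the class and moves `w`
    -- into `[1, N]`.
    obtain ⟨n, hn⟩ := exists_mem_Ico_zpow w.2 hN
    have hN0 : 0 < (pointNorm (normProj X₀ K x) : ℝ) := zero_lt_one.trans hN
    let v : {r : ℝ // 0 < r} := ⟨(pointNorm (normProj X₀ K x) : ℝ) ^ (-n), zpow_pos hN0 _⟩
    have hv := (stabilizer_eq_of_mem_packet hK h hz v).2 ⟨-n, rfl⟩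
    refine ⟨(Q, w * v), ⟨⟨hτ, hinj⟩, ?_, ?_⟩, hv⟩
    · change (1 : ℝ) ≤ w * (pointNorm (normProj X₀ K x) : ℝ) ^ (-n)
      rw [zpow_neg, ← div_eq_mul_inv, one_le_div (zpow_pos hN0 _)]
      exact hn.1
    · change w * (pointNorm (normProj X₀ K x) : ℝ) ^ (-n) ≤ pointNorm (normProj X₀ K x)
      rw [zpow_neg, ← div_eq_mul_inv, div_le_iff₀ (zpow_pos hN0 _), ← zpow_one_add₀ hN0.ne',
        add_comm]
      exact hn.2.le
  · rintro ⟨⟨Q, w⟩, ⟨⟨hQ, -⟩, -⟩, rfl⟩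
    exact mk_mem_packet_iff.2 (congrArg (normProj X₀ K) hQ)

end Compactness

/-! ### Periods, periodic orbits and absence of fixed points. -/

section Orbits

variable {X₀ : Scheme.{u}} [IsArithmeticScheme X₀]
  {K : Type u} [Field K] [Algebra X₀.functionField K] {E : CharCondition X₀ K}

lemma log_pointNorm_pos {x₀ : X₀} (h : IsClosed {x₀}) : 0 < Real.log (pointNorm x₀) :=
  Real.log_pos (by exact_mod_cast one_lt_pointNorm h)

lemma range_flow_subset_packet {x₀ : X₀} {z : PhaseSpace E} (hz : z ∈ packet E x₀) :
    (Set.range fun t : ℝ => Susp.flow t z) ⊆ packet E x₀ := by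
  rintro _ ⟨t, rfl⟩
  exact smul_mem_packet hz _

variable [IsGalois X₀.functionField K]

/-- The periods of the points in the packet of a closed point. -/
lemma flow_eq_self_iff_of_mem_packet (hK : IsRadiciallyClosed K) {x₀ : X₀} (h : IsClosed {x₀})
    {z : PhaseSpace E} (hz : z ∈ packet E x₀) (t : ℝ) :
    Susp.flow t z = z ↔ ∃ n : ℤ, t = n * Real.log (pointNorm x₀) := by
  have h0 : (0 : ℝ) < pointNorm x₀ := by exact_mod_cast zero_lt_one.trans (one_lt_pointNorm h)
  rw [Susp.flow_eq_self_iff, stabilizer_eq_of_mem_packet hK h hz]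
  refine exists_congr fun n => ?_
  rw [← Real.log_zpow]
  exact ⟨fun hn => by rw [← hn, Real.log_exp], fun hn => by subst hn; exact Real.exp_log (zpow_pos h0 n)⟩

/-- Points with nontrivial isotropy lie over closed points. -/
lemma isClosed_of_mem_stabilizer {x₀ : X₀} {z : PhaseSpace E} (hz : z ∈ packet E x₀)
    {v : {r : ℝ // 0 < r}} (hv : v ∈ MulAction.stabilizer {r : ℝ // 0 < r} z) (hv1 : v ≠ 1) :
    IsClosed {x₀} := by
  by_contra h
  rw [stabilizer_eq_bot_of_mem_packet h hz] at hv
  exact hv1 (Subgroup.mem_bot.1 hv)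

lemma isClosed_of_flow_eq_self {x₀ : X₀} {z : PhaseSpace E} (hz : z ∈ packet E x₀)
    {t : ℝ} (ht : Susp.flow t z = z) (h0 : t ≠ 0) : IsClosed {x₀} :=
  isClosed_of_mem_stabilizer hz ((Susp.flow_eq_self_iff t z).1 ht) fun h =>
    h0 (Real.exp_eq_one_iff t |>.1 (congrArg Subtype.val h))

lemma isPeriodicOrbit_range_flow (hK : IsRadiciallyClosed K) {x₀ : X₀} (h : IsClosed {x₀})
    {z : PhaseSpace E} (hz : z ∈ packet E x₀) :
    Susp.IsPeriodicOrbit (Set.range fun t : ℝ => Susp.flow t z) (Real.log (pointNorm x₀)) :=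
  ⟨log_pointNorm_pos h, z, rfl, Set.ext (flow_eq_self_iff_of_mem_packet hK h hz)⟩

lemma exists_flow_ne (hK : IsRadiciallyClosed K) (z : PhaseSpace E) :
    ∃ t : ℝ, Susp.flow t z ≠ z := by
  by_contra! hfix
  obtain ⟨x₀, hz⟩ := exists_mem_packet z
  have h := isClosed_of_flow_eq_self hz (hfix 1) one_ne_zero
  have hpos := log_pointNorm_pos h
  -- Half of the least period cannot be an integral multiple of it.
  obtain ⟨n, hn⟩ := (flow_eq_self_iff_of_mem_packet hK h hz (Real.log (pointNorm x₀) / 2)).1 (hfix _)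
  have h2 : ((2 * n : ℤ) : ℝ) = (1 : ℤ) := by
    push_cast
    exact mul_right_cancel₀ hpos.ne' (by linarith)
  have : 2 * n = 1 := by exact_mod_cast h2
  omega

lemma setOf_stabilizer_ne_bot (hK : IsRadiciallyClosed K) :
    {z : PhaseSpace E | MulAction.stabilizer {r : ℝ // 0 < r} z ≠ ⊥} =
      ⋃ x₀ ∈ {x₀ : X₀ | IsClosed {x₀}}, packet E x₀ := by
  ext z
  simp only [Set.mem_ofPred_eq, Set.mem_iUnion, exists_prop]
  constructor
  · intro hne
    obtain ⟨x₀, hz⟩ := exists_mem_packet z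
    obtain ⟨v, hv, hv1⟩ := (Subgroup.bot_or_exists_ne_one _).resolve_left hne
    exact ⟨x₀, isClosed_of_mem_stabilizer hz hv hv1, hz⟩
  · rintro ⟨x₀, h, hz⟩ hbot
    have h1 := one_lt_pointNorm h
    have hN := (stabilizer_eq_of_mem_packet hK h hz
      ⟨pointNorm x₀, by exact_mod_cast zero_lt_one.trans h1⟩).2 ⟨1, (zpow_one _).symm⟩
    rw [hbot, Subgroup.mem_bot] at hN
    have : (pointNorm x₀ : ℝ) = 1 := congrArg Subtype.val hN
    exact h1.ne' (by exact_mod_cast this)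

lemma existsUnique_packet_of_isPeriodicOrbit {γ : Set (PhaseSpace E)} {ℓ : ℝ}
    (hγ : Susp.IsPeriodicOrbit γ ℓ) : ∃! x₀ : X₀, IsClosed {x₀} ∧ γ ⊆ packet E x₀ := by
  obtain ⟨hℓ, z, rfl, hper⟩ := hγ
  obtain ⟨x₀, hz⟩ := exists_mem_packet z
  have hzℓ : Susp.flow ℓ z = z := (Set.ext_iff.1 hper ℓ).2 ⟨1, by simp⟩
  refine ⟨x₀, ⟨isClosed_of_flow_eq_self hz hzℓ hℓ.ne', range_flow_subset_packet hz⟩, ?_⟩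
  rintro y₀ ⟨-, hy⟩
  -- The point `z` lies on its own orbit, as its translate by the period `ℓ`.
  exact eq_of_mem_packet (hy ⟨ℓ, hzℓ⟩) hz

end Orbits

end ArithDyn

end

theorem theorem3 (X₀ : Scheme.{u}) [ArithDyn.IsArithmeticScheme X₀]
    (K : Type u) [Field K] [Algebra X₀.functionField K] [IsGalois X₀.functionField K]
    (hK : ArithDyn.IsRadiciallyClosed K) (E : ArithDyn.CharCondition X₀ K) :
    -- the points with nontrivial isotropy are the disjoint union of the packets
    {z : ArithDyn.PhaseSpace E | MulAction.stabilizer {r : ℝ // 0 < r} z ≠ ⊥} =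
        (⋃ x₀ ∈ {x₀ : X₀ | IsClosed {x₀}}, ArithDyn.packet E x₀) ∧
    {x₀ : X₀ | IsClosed {x₀}}.PairwiseDisjoint (ArithDyn.packet E) ∧
    -- the isotropy groups, as sets of positive real numbers
    (∀ x₀ : X₀, IsClosed {x₀} → ∀ z ∈ ArithDyn.packet E x₀,
      (MulAction.stabilizer {r : ℝ // 0 < r} z : Set {r : ℝ // 0 < r}) =
        {v : {r : ℝ // 0 < r} | ∃ n : ℤ, (v : ℝ) = (ArithDyn.pointNorm x₀ : ℝ) ^ n}) ∧
    -- the packets are nonempty, compact, and consist of periodic orbits of length `log N x₀`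
    (∀ x₀ : X₀, IsClosed {x₀} → Finite (X₀.residueField x₀) ∧
      (ArithDyn.packet E x₀).Nonempty ∧ IsCompact (ArithDyn.packet E x₀) ∧
      ∀ z ∈ ArithDyn.packet E x₀,
        Set.range (fun t : ℝ => ArithDyn.Susp.flow t z) ⊆ ArithDyn.packet E x₀ ∧
        ArithDyn.Susp.IsPeriodicOrbit (Set.range (fun t : ℝ => ArithDyn.Susp.flow t z))
          (Real.log (ArithDyn.pointNorm x₀))) ∧
    -- every periodic orbit lies in exactly one packet
    (∀ (γ : Set (ArithDyn.PhaseSpace E)) (ℓ : ℝ), ArithDyn.Susp.IsPeriodicOrbit γ ℓ →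
      ∃! x₀ : X₀, IsClosed {x₀} ∧ γ ⊆ ArithDyn.packet E x₀) ∧
    -- there are no fixed points of the flow
    (∀ z : ArithDyn.PhaseSpace E, ∃ t : ℝ, ArithDyn.Susp.flow t z ≠ z) := by
  open ArithDyn in
  exact ⟨setOf_stabilizer_ne_bot hK,
    fun x₀ _ y₀ _ hne => Set.disjoint_left.2 fun _ hx hy => hne (eq_of_mem_packet hx hy),
    fun x₀ h z hz => Set.ext (stabilizer_eq_of_mem_packet hK h hz),
    fun x₀ h => ⟨finite_residueField_base h, nonempty_packet h, isCompact_packet hK h,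
      fun z hz => ⟨range_flow_subset_packet hz, isPeriodicOrbit_range_flow hK h hz⟩⟩,
    fun _ _ hγ => existsUnique_packet_of_isPeriodicOrbit hγ,
    exists_flow_ne hK⟩
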